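/- Setting. A positive random variable $R$ has distribution function $F$ with infinite upper endpoint, $\overline F=1-F$, and $F$ is in the Gumbel max-domain of attraction with a positive scaling function $w$: $\lim_{x\to\infty}\overline F(x+t/w(x))/\overline F(x)=e^{-t}$ for all $t\in\mathbb R$. Let $a\in(0,1]$. For a random vector $(X,Y)$ and $x>0$ let $(X^{[x]},Y^{[ax]})$ denote a random vector with the conditional distribution of $(X-x,\,Y-ax)$ given $X>x,\ Y>ax$. Below, convergence in distribution holds as $x\to\infty$ through the reals, in particular along $x=n\in\mathbb N$, and the conditioning events have positive probability for all $x>0$. (A) Let $(X,Y)$ have the distribution of $(RU_1,RU_2)$ with $R$ independent of $(U_1,U_2)$, $U_1\in(0,1]$ almost surely with upper endpoint $1$. With $U_a=\min(U_1,U_2/a)$, assume that for all $\delta,\eta\in[0,\infty)$ and $s\in(0,\infty)$ $$\lim_{x\to\infty}\frac{P\{U_1>1-(s-\delta)/x,\ U_2>a(1-(s-\eta)/x)\}}{P\{U_a>1-1/x\}}=\xi_a(s,\delta,\eta),\qquad \xi_a(s,0,0)>0 .$$ Then $J_{\delta,\eta}:=\int_\delta^\infty \xi_a(s,\delta,\eta)e^{-s}\,ds\in(0,\infty)$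 for all $\delta,\eta\ge 0$, and for all $s,t\ge 0$ $$\lim_{x\to\infty}P\{w(x)X^{[x]}>s,\ w(x)Y^{[ax]}>t\}=\frac{J_{s,t/a}}{J_{0,0}} .$$ Moreover there is a random vector $(E_1,E_2)$ with values in $(0,\infty)\times(0,\infty]$ and survivor function $P\{E_1>s,E_2>t\}=J_{s,t/a}/J_{0,0}$, $s,t\ge0$, such that $(w(x)X^{[x]},w(x)Y^{[ax]})$ converges in distribution to $(E_1,E_2)$, as random vectors in $\mathbb R\times[-\infty,\infty]$. If $\lim_{t\to\infty}J_{0,t}=0$, then $(E_1,E_2)$ has values in $(0,\infty)^2$ and the convergence in distribution holds in $\mathbb R^2$. (B) Let $(X,Y)$ have the distribution of $(RI_1W,\ \rho RI_1W+RI_2z^*(W))$, where $\rho\in(-1,1)$; $(I_1,I_2)$, $R$, $W$ are mutually independent; $I_1,I_2\in\{-1,1\}$ and $P\{I_1=I_2=1\}>0$; $W\in(0,1)$ has upper endpoint $1$ and a density $h$ that is continuous at $1/a_\rho$ with $h(1/a_\rho)>0$; and $z^*:[0,1]\to[0,1]$ is measurable. Put $z(x)=\rho x+z^*(x)$. Assume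 that $1<a_\rho<a/|\rho|$ (with $a/0=\infty$), and that for some $\varepsilon\in(0,1)$ with $V_\varepsilon=[1/a_\rho-\varepsilon,1/a_\rho+\varepsilon]\subseteq[0,1]$: $z$ is strictly decreasing on $V_\varepsilon$; $z(x)\le a/a_\rho$ for $x\in(1/a_\rho,1]$; $\sup_{x\in(1/a_\rho+\varepsilon,1]}z(x)<a/a_\rho$ (no condition if this interval is empty); $z(V_\varepsilon)$ contains a neighbourhood of $a/a_\rho$; and the inverse $z_\varepsilon$ of $z$ on $V_\varepsilon$ satisfies, for some $c\in(0,\infty)$, as $x\to\infty$ and locally uniformly in $d>0$, $$z_\varepsilon(a/a_\rho-d/x)-1/a_\rho\sim \frac{cd}{x},\qquad z_\varepsilon(a/a_\rho+d/x)-1/a_\rho\sim-\frac{cd}{x}.$$ Then, with $g(x)=w(a_\rho x)$, $(g(x)X^{[x]},g(x)Y^{[ax]})$ converges in distribution to $(E_1,E_2)$, where $E_1,E_2$ are independent exponential random variables with rates $$D_{a,c}=\frac{a_\rho}{ca+1},\qquad D^*_{a,c}=\frac{a_\rho c}{ca+1}.$$ -/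

import Mathlib

open MeasureTheory ProbabilityTheory Filter Topology Set

/-- The random variable `R` has a distribution function with infinite upper endpoint which lies in
the Gumbel max-domain of attraction with positive scaling function `w`: with `Fbar` the survivor
function of `R`, `Fbar (x + t / w x) / Fbar x → exp (-t)` as `x → ∞`, for every real `t`. -/
structure GumbelMDA {Ω : Type*} [MeasurableSpace Ω] (P : Measure Ω) (R : Ω → ℝ)
    (w : ℝ → ℝ) : Prop where
  infinite_endpoint : ∀ x : ℝ, 0 < P.real {ω | x < R ω}
  w_pos : ∀ x : ℝ, 0 < x → 0 < w x
  tendsto : ∀ t : ℝ,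
    Tendsto (fun x : ℝ => P.real {ω | x + t / w x < R ω} / P.real {ω | x < R ω})
      atTop (𝓝 (Real.exp (-t)))

/-- The unconstrained dependence model: `R > 0` is independent of `(U₁, U₂)`, its distribution is in
the Gumbel max-domain of attraction, `U₁ ∈ (0, 1]` has upper endpoint `1`, and `(U₁, U₂)` has the
prescribed behaviour near the point `(1, a)`, with limit function `ξ s δ η`. -/
structure ModelA {Ω : Type*} [MeasurableSpace Ω] (P : Measure Ω) (R U₁ U₂ : Ω → ℝ)
    (w : ℝ → ℝ) (a : ℝ) (ξ : ℝ → ℝ → ℝ → ℝ) : Prop where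
  measurable_R : Measurable R
  measurable_U₁ : Measurable U₁
  measurable_U₂ : Measurable U₂
  R_pos : ∀ᵐ ω ∂P, 0 < R ω
  indep : IndepFun R (fun ω => (U₁ ω, U₂ ω)) P
  gumbel : GumbelMDA P R w
  U₁_mem : ∀ᵐ ω ∂P, U₁ ω ∈ Ioc (0 : ℝ) 1
  U₁_endpoint : ∀ r : ℝ, r < 1 → 0 < P.real {ω | r < U₁ ω}
  a_mem : a ∈ Ioc (0 : ℝ) 1
  tendsto : ∀ δ η s : ℝ, 0 ≤ δ → 0 ≤ η → 0 < s →
    Tendsto (fun x : ℝ =>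
        P.real {ω | 1 - (s - δ) / x < U₁ ω ∧ a * (1 - (s - η) / x) < U₂ ω} /
          P.real {ω | 1 - 1 / x < min (U₁ ω) (U₂ ω / a)})
      atTop (𝓝 (ξ s δ η))
  ξ_pos : ∀ s : ℝ, 0 < s → 0 < ξ s 0 0

/-- The constants `J_{δ, η} = ∫_δ^∞ ξ(s, δ, η) exp(-s) ds`. -/
noncomputable def Jint (ξ : ℝ → ℝ → ℝ → ℝ) (δ η : ℝ) : ℝ :=
  ∫ s in Ioi δ, ξ s δ η * Real.exp (-s)

/-- The functional dependence model, with `z x = ρ x + zstar x`, with `zinv` the inverse of `z` on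
`V = [1/aρ - ε, 1/aρ + ε]`, and with `h` a density of `W`. The mutual independence of `(I₁, I₂)`,
`R` and `W` is written as independence of `(I₁, I₂)` from `(R, W)` and of `R` from `W`. -/
structure ModelB {Ω : Type*} [MeasurableSpace Ω] (P : Measure Ω) (R W I₁ I₂ : Ω → ℝ)
    (w : ℝ → ℝ) (a ρ aρ c ε : ℝ) (zstar zinv h : ℝ → ℝ) : Prop where
  measurable_R : Measurable R
  measurable_W : Measurable W
  measurable_I₁ : Measurable I₁
  measurable_I₂ : Measurable I₂
  indep_I : IndepFun (fun ω => (I₁ ω, I₂ ω)) (fun ω => (R ω, W ω)) P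
  indep_RW : IndepFun R W P
  R_pos : ∀ᵐ ω ∂P, 0 < R ω
  gumbel : GumbelMDA P R w
  W_mem : ∀ᵐ ω ∂P, W ω ∈ Ioo (0 : ℝ) 1
  W_endpoint : ∀ r : ℝ, r < 1 → 0 < P.real {ω | r < W ω}
  I₁_sign : ∀ᵐ ω ∂P, I₁ ω = -1 ∨ I₁ ω = 1
  I₂_sign : ∀ᵐ ω ∂P, I₂ ω = -1 ∨ I₂ ω = 1
  I_pos : 0 < P.real {ω | I₁ ω = 1 ∧ I₂ ω = 1}
  ρ_mem : ρ ∈ Ioo (-1 : ℝ) 1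
  a_mem : a ∈ Ioc (0 : ℝ) 1
  measurable_zstar : Measurable zstar
  zstar_mem : ∀ x ∈ Icc (0 : ℝ) 1, zstar x ∈ Icc (0 : ℝ) 1
  /- `1 < aρ < a / |ρ|`, where `a / 0 = ∞` -/
  one_lt_aρ : 1 < aρ
  aρ_lt : aρ * |ρ| < a
  ε_mem : ε ∈ Ioo (0 : ℝ) 1
  V_subset : Icc (1 / aρ - ε) (1 / aρ + ε) ⊆ Icc 0 1
  z_anti : StrictAntiOn (fun x => ρ * x + zstar x) (Icc (1 / aρ - ε) (1 / aρ + ε))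
  z_le : ∀ x ∈ Ioc (1 / aρ) 1, ρ * x + zstar x ≤ a / aρ
  z_away : ∃ κ : ℝ, κ < a / aρ ∧ ∀ x ∈ Ioc (1 / aρ + ε) 1, ρ * x + zstar x ≤ κ
  zinv_left : LeftInvOn zinv (fun x => ρ * x + zstar x) (Icc (1 / aρ - ε) (1 / aρ + ε))
  zinv_dom : (fun x => ρ * x + zstar x) '' Icc (1 / aρ - ε) (1 / aρ + ε) ∈ 𝓝 (a / aρ)
  c_pos : 0 < c
  zinv_below : TendstoLocallyUniformlyOn
    (fun x d : ℝ => (zinv (a / aρ - d / x) - 1 / aρ) / (c * d / x)) (fun _ => 1) atTop (Ioi 0)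
  zinv_above : TendstoLocallyUniformlyOn
    (fun x d : ℝ => (zinv (a / aρ + d / x) - 1 / aρ) / (-(c * d / x))) (fun _ => 1) atTop (Ioi 0)
  measurable_h : Measurable h
  h_nonneg : ∀ x, 0 ≤ h x
  h_density : P.map W = (volume : Measure ℝ).withDensity (fun x => ENNReal.ofReal (h x))
  h_cont : ContinuousAt h (1 / aρ)
  h_pos : 0 < h (1 / aρ)

/-- The event `{X > x, Y > a x}`. -/
def exceedance {Ω : Type*} (X Y : Ω → ℝ) (a x : ℝ) : Set Ω :=
  {ω | x < X ω ∧ a * x < Y ω}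

/-- The law of `(g(x) (X - x), g(x) (Y - a x))` conditionally on `X > x, Y > a x`. -/
noncomputable def excessLaw {Ω : Type*} [MeasurableSpace Ω] (P : Measure Ω) (X Y : Ω → ℝ)
    (a : ℝ) (g : ℝ → ℝ) (x : ℝ) : Measure (ℝ × ℝ) :=
  (P[|exceedance X Y a x]).map (fun ω => (g x * (X ω - x), g x * (Y ω - a * x)))

/-- The same law, regarded as a law on `ℝ × [-∞, ∞]`. -/
noncomputable def excessLawExt {Ω : Type*} [MeasurableSpace Ω] (P : Measure Ω) (X Y : Ω → ℝ)
    (a : ℝ) (g : ℝ → ℝ) (x : ℝ) : Measure (ℝ × EReal) :=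
  (excessLaw P X Y a g x).map (fun p => (p.1, (p.2 : EReal)))

/-- The measures `law x`, `x > 0`, are probability measures, and they converge weakly, as `x → ∞`
through the reals (in particular along `x = n`), to the probability measure `L`. -/
def ConvergesInLaw {E : Type*} [TopologicalSpace E] [MeasurableSpace E] [OpensMeasurableSpace E]
    (law : ℝ → Measure E) (L : Measure E) : Prop :=
  ∃ (ν : ℝ → ProbabilityMeasure E) (μ : ProbabilityMeasure E),
    (∀ x, 0 < x → (ν x : Measure E) = law x) ∧ (μ : Measure E) = L ∧ Tendsto ν atTop (𝓝 μ)

/-! Both models are instances of `RadialModel`: a Gumbel radius `R` independent of `(V₁, V₂)`, with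
`min V₁ V₂ ≤ 1` and the law of `(V₁, V₂)` prescribed near `(1, 1)`. Write `Fbar` for the survivor
function of `R`. If `R = y + s / w y`, then `R V₁ > y + δ / w y` means `V₁ > 1 - (s - δ) / (y w(y) +
s)`, and similarly for `V₂` and `η`. Since `y w(y) → ∞`, the conditional probability of both,
divided by `tipTail (y w(y))`, tends to `ξ s δ η`, while `s` is asymptotically exponential given `R
> y`. Hence the joint excess probability divided by `Fbar(y) tipTail(y w(y))` tends to `∫ ξ s δ η
exp(-s) ds` (`tendsto_jointExcess`). Monotonicity of `tipMass` makes this rigorous through Riemann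
sums over short blocks of `s`. Large `s` is negligible because `tipTail` grows at most polynomially
(`exists_tipTail_bound`) and the tail of `R` decays faster than any power (`exists_tail_le`).

Weak convergence comes from compactness of the probability measures on `[-∞, ∞]²`: every cluster
point has the same survivor function, so the limit exists, and it descends to an open subspace that
carries it. In model A the required right-continuity comes from the diagonal identity `J_{δ+d, η+d}
= exp(-d) J_{δ, η}` (`Jint_add`).

In model B only `I₁ = I₂ = 1` matters: `I₁ = -1` makes the first component negative, and `I₂ = -1`
forces `R` beyond a multiple of `aρ x` larger than one. The local inverse of `z` turns the tip event
into `W` lying in a window of width of order `1 / v` around `1 / aρ`, so continuity of the density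
gives a `ξ` that is the positive part of `s - (c a η + δ) / (c a + 1)`. Its integral is exponential
in `δ` and `η`, which yields the independent exponential limits. -/

set_option linter.unusedSectionVars false

/-! ### Tails in the Gumbel domain of attraction. -/

section GumbelTail

variable {Ω : Type*} [MeasurableSpace Ω] {P : Measure Ω} [IsProbabilityMeasure P]
  {R : Ω → ℝ} {w : ℝ → ℝ}

lemma survivor_antitone : Antitone fun x : ℝ => P.real {ω | x < R ω} :=
  fun _ _ hxy => measureReal_mono fun _ hω => lt_of_le_of_lt hxy hω

lemma tendsto_survivor_atTop (hR : Measurable R) :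
    Tendsto (fun x : ℝ => P.real {ω | x < R ω}) atTop (𝓝 0) := by
  have h1 : (fun x : ℝ => P.real {ω | x < R ω}) = fun x => 1 - cdf (P.map R) x := by
    funext x
    have : IsProbabilityMeasure (P.map R) := Measure.isProbabilityMeasure_map hR.aemeasurable
    rw [cdf_eq_real, map_measureReal_apply hR measurableSet_Iic,
      ← probReal_compl_eq_one_sub (hR measurableSet_Iic)]
    congr 1
    ext ω
    simp
  rw [h1]
  simpa using (tendsto_cdf_atTop (P.map R)).const_sub 1

/-- The scaling function satisfies `x w(x) → ∞`. -/
lemma GumbelMDA.tendsto_mul_scaling (h : GumbelMDA P R w) (hR : Measurable R)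
    (hpos : ∀ᵐ ω ∂P, 0 < R ω) : Tendsto (fun x => x * w x) atTop atTop := by
  rw [tendsto_atTop]
  intro M
  set M' := max M 1 with hM'
  have h1 : (1 : ℝ) ≤ M' := le_max_right _ _
  have hF := tendsto_survivor_atTop (P := P) hR
  have hexp : 0 < Real.exp (-(-M')) + 1 := by positivity
  have hb := (h.tendsto (-M')).eventually_lt_const (lt_add_one _)
  have hs := hF.eventually_lt_const (inv_pos.2 hexp)
  filter_upwards [hb, hs, eventually_gt_atTop 0] with x hx1 hx2 hx0
  -- If `x w(x) < M'`, then `x - M' / w x ≤ 0` and the survivor function is `1` there. The ratio `1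
  -- / Fbar(x)` would then stay below `exp M' + 1`, although `Fbar(x)` is already smaller than the
  -- inverse of that bound.
  by_contra! hlt
  have hw := h.w_pos x hx0
  have hle : x + -M' / w x ≤ 0 := by
    have : x ≤ M' / w x := by
      rw [le_div_iff₀ hw]
      exact hlt.le.trans (le_max_left _ _)
    rw [neg_div]
    linarith
  have hone : P.real {ω | x + -M' / w x < R ω} = 1 := by
    rw [← probReal_univ (μ := P)]
    refine measureReal_congr ?_
    filter_upwards [hpos] with ω hω
    exact eq_true (lt_of_le_of_lt hle hω)
  rw [hone, div_lt_iff₀ (h.infinite_endpoint x)] at hx1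
  rw [lt_inv_comm₀ (h.infinite_endpoint x) hexp] at hx2
  have := mul_lt_mul_of_pos_right hx2 (h.infinite_endpoint x)
  rw [inv_mul_cancel₀ (h.infinite_endpoint x).ne'] at this
  linarith

/-- The reciprocal of the scaling function varies slowly over one unit of itself. -/
lemma GumbelMDA.eventually_scaling_le (h : GumbelMDA P R w) {ε : ℝ} (hε : 0 < ε) :
    ∀ᶠ x in atTop, 1 / w (x + 1 / w x) ≤ (1 + ε) / w x := by
  have hstep : Tendsto (fun x => x + 1 / w x) atTop atTop := by
    refine tendsto_atTop_mono' _ ?_ tendsto_id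
    filter_upwards [eventually_gt_atTop 0] with x hx
    have := h.w_pos x hx
    simp only [id]
    have : 0 < 1 / w x := by positivity
    linarith
  -- Relative to `Fbar` at `x + 1 / w x`, the next own unit of `w` costs a factor tending to
  -- `exp(-1)`, whereas moving on to `x + (2 + ε) / w x` costs `exp(-(1 + ε))`. The next unit
  -- therefore cannot reach beyond that point.
  have h1 := (h.tendsto 1).comp hstep
  have h2 := (h.tendsto (2 + ε)).div (h.tendsto 1) (Real.exp_pos _).ne'
  have hlt : Real.exp (-(2 + ε)) / Real.exp (-1) < Real.exp (-1) := by
    rw [← Real.exp_sub]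
    exact Real.exp_lt_exp.2 (by linarith)
  filter_upwards [h2.eventually_lt h1 hlt, eventually_gt_atTop 0] with x hx hx0
  by_contra! hcon
  have hw := h.w_pos x hx0
  have hle : x + (2 + ε) / w x ≤ x + 1 / w x + 1 / w (x + 1 / w x) := by
    have : (2 + ε) / w x = 1 / w x + (1 + ε) / w x := by rw [← add_div]; ring_nf
    linarith
  have hmono := survivor_antitone (P := P) (R := R) hle
  simp only [Pi.div_apply, Function.comp] at hx
  rw [div_div_div_cancel_right₀ (h.infinite_endpoint x).ne'] at hx
  have := div_le_div_of_nonneg_right hmono (h.infinite_endpoint (x + 1 / w x)).le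
  simp only at this
  linarith

/-- Each step from `x` to `x + 1 / w x` at least halves the tail, because `exp(-1) < 1/2`, and the
next step is at most `1 + ε` times as long. So `k` steps cover at most the geometric sum `((1 + ε)^k
- 1) / ε` of original units. -/
lemma GumbelMDA.eventually_geometric_decay (h : GumbelMDA P R w) {ε : ℝ} (hε : 0 < ε) :
    ∃ x₀ > 0, ∀ (k : ℕ), ∀ x ≥ x₀,
      P.real {ω | x + ((1 + ε) ^ k - 1) / ε / w x < R ω} ≤ (1 / 2) ^ k * P.real {ω | x < R ω} := by
  have hlt : Real.exp (-1) < 1 / 2 := by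
    have := Real.exp_neg_one_lt_half
    simpa using this
  obtain ⟨x₀, hx₀⟩ := eventually_atTop.1 (((h.tendsto 1).eventually_lt_const hlt).and
    (h.eventually_scaling_le hε))
  refine ⟨max x₀ 1, by positivity, fun k => ?_⟩
  induction k with
  | zero => intro x _; simp
  | succ k ih =>
    intro x hx
    have hx0 : 0 < x := lt_of_lt_of_le one_pos ((le_max_right _ _).trans hx)
    have hw := h.w_pos x hx0
    obtain ⟨ha, hb⟩ := hx₀ x ((le_max_left _ _).trans hx)
    have hy : x ≤ x + 1 / w x := by
      have : 0 < 1 / w x := by positivity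
      linarith
    have hk : 0 ≤ ((1 + ε) ^ k - 1) / ε :=
      div_nonneg (sub_nonneg.2 (one_le_pow₀ (by linarith))) hε.le
    rw [div_lt_iff₀ (h.infinite_endpoint x)] at ha
    have hle : x + 1 / w x + ((1 + ε) ^ k - 1) / ε / w (x + 1 / w x)
        ≤ x + ((1 + ε) ^ (k + 1) - 1) / ε / w x := by
      have h3 := mul_le_mul_of_nonneg_left hb hk
      have h4 : ((1 + ε) ^ (k + 1) - 1) / ε / w x
          = 1 / w x + ((1 + ε) ^ k - 1) / ε * ((1 + ε) / w x) := by
        field_simp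
        ring
      rw [h4]
      calc _ = x + 1 / w x + ((1 + ε) ^ k - 1) / ε * (1 / w (x + 1 / w x)) := by ring
        _ ≤ _ := by linarith
    calc _ ≤ P.real {ω | x + 1 / w x + ((1 + ε) ^ k - 1) / ε / w (x + 1 / w x) < R ω} :=
          survivor_antitone hle
      _ ≤ (1 / 2) ^ k * P.real {ω | x + 1 / w x < R ω} := ih _ (hx.trans hy)
      _ ≤ (1 / 2) ^ k * (1 / 2 * P.real {ω | x < R ω}) := by gcongr
      _ = _ := by ring

/-- Uniform polynomial decay of every order for the normalised excesses of `R`. -/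
lemma GumbelMDA.exists_tail_le (h : GumbelMDA P R w) (p : ℕ) :
    ∃ C > 0, ∃ x₀ > 0, ∀ x ≥ x₀, ∀ s ≥ 0,
      (1 + s) ^ p * P.real {ω | x + s / w x < R ω} ≤ C * P.real {ω | x < R ω} := by
  -- With `(1 + ε)^p ≤ 2`, the factor `(1 + s)^p` at most doubles, up to constants, with each
  -- halving of the tail.
  obtain ⟨ε, hε, hε1, hp⟩ : ∃ ε : ℝ, 0 < ε ∧ ε ≤ 1 ∧ (1 + ε) ^ p ≤ 2 := by
    have hc : Tendsto (fun ε : ℝ => (1 + ε) ^ p) (𝓝[>] 0) (𝓝 ((1 + 0) ^ p)) :=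
      ((continuous_const.add continuous_id).pow p).continuousAt.mono_left nhdsWithin_le_nhds
    have h1 := hc.eventually_lt_const (u := 2) (by norm_num)
    have h2 : ∀ᶠ ε : ℝ in 𝓝[>] 0, ε ∈ Ioc 0 1 := Ioc_mem_nhdsGT one_pos
    obtain ⟨ε, ha, hb⟩ := (h1.and h2).exists
    exact ⟨ε, hb.1, hb.2, ha.le⟩
  obtain ⟨x₀, hx₀, H⟩ := h.eventually_geometric_decay hε
  refine ⟨2 / ε ^ p, by positivity, x₀, hx₀, fun x hx s hs => ?_⟩
  have hw := h.w_pos x (hx₀.trans_le hx)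
  obtain ⟨k, hk1, hk2⟩ := exists_nat_pow_near (x := 1 + ε * s) (y := 1 + ε)
    (by nlinarith) (by linarith)
  have hle : x + ((1 + ε) ^ k - 1) / ε / w x ≤ x + s / w x := by
    have : ((1 + ε) ^ k - 1) / ε ≤ s := by
      rw [div_le_iff₀ hε]
      linarith
    gcongr
  have h1 : P.real {ω | x + s / w x < R ω} ≤ (1 / 2) ^ k * P.real {ω | x < R ω} :=
    (survivor_antitone hle).trans (H k x hx)
  have h2 : (1 + s) ^ p ≤ 2 ^ (k + 1) / ε ^ p := by
    rw [le_div_iff₀ (by positivity), ← mul_pow]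
    calc ((1 + s) * ε) ^ p ≤ ((1 + ε) ^ (k + 1)) ^ p := by
          gcongr
          nlinarith
      _ = ((1 + ε) ^ p) ^ (k + 1) := by rw [← pow_mul, ← pow_mul, mul_comm]
      _ ≤ 2 ^ (k + 1) := by gcongr
  calc _ ≤ 2 ^ (k + 1) / ε ^ p * ((1 / 2) ^ k * P.real {ω | x < R ω}) := by gcongr
    _ = 2 / ε ^ p * (2 ^ k * (1 / 2) ^ k) * P.real {ω | x < R ω} := by ring
    _ = _ := by rw [← mul_pow]; norm_num

end GumbelTail

/-- Polynomial bound for an antitone function with bounded ratios `H (v / 2) / H v`. -/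
lemma exists_le_pow_mul_of_tendsto_ratio {H : ℝ → ℝ} {b : ℝ} (hb : 0 < b)
    (hanti : AntitoneOn H (Ioi 0)) (h0 : ∀ v, 0 ≤ H v) (h1 : ∀ v, H v ≤ 1)
    (hlim : Tendsto (fun v => H (v / 2) / H v) atTop (𝓝 b)) :
    ∃ (q : ℕ), ∃ C > 0, ∃ v₀ > 0, ∀ v ≥ v₀, 0 < H v ∧
      ∀ s ≥ 0, H (v / (1 + s)) ≤ C * (1 + s) ^ q * H v := by
  -- Far out, each halving of the argument multiplies `H` by at most `2 ^ q`.
  obtain ⟨q, hq⟩ := pow_unbounded_of_one_lt b one_lt_two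
  obtain ⟨v₁, hv₁⟩ := eventually_atTop.1
    ((hlim.eventually_lt_const hq).and (hlim.eventually_const_lt hb))
  set v₀ := max v₁ 1
  have hv₀ : 0 < v₀ := by positivity
  have hpos : ∀ v ≥ v₀, 0 < H v := by
    intro v hv
    have h2 := (hv₁ v ((le_max_left _ _).trans hv)).2
    by_contra hn
    -- Division by zero gives `0`, so a vanishing `H v` would contradict the eventual positivity of
    -- the ratio.
    have : H v = 0 := le_antisymm (not_lt.1 hn) (h0 v)
    simp [this] at h2
  have hdyad : ∀ (k : ℕ), ∀ v ≥ v₀, H (v / 2 ^ k) ≤ 1 / H (2 * v₀) * (2 ^ k) ^ q * H v := by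
    have hC := hpos (2 * v₀) (by linarith)
    -- For `v ≤ 2 v₀`, halving may leave the range where the ratio is controlled. The trivial bound
    -- `H ≤ 1` suffices there and fixes the constant `1 / H (2 v₀)`.
    have hsmall : ∀ (k : ℕ), ∀ v ≥ v₀, v ≤ 2 * v₀ →
        H (v / 2 ^ k) ≤ 1 / H (2 * v₀) * (2 ^ k) ^ q * H v := by
      intro k v hv hv2
      have h3 : H (2 * v₀) ≤ H v :=
        hanti (show 0 < v by linarith) (show 0 < 2 * v₀ by linarith) hv2
      calc H (v / 2 ^ k) ≤ 1 := h1 _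
        _ ≤ 1 / H (2 * v₀) * H v := by rw [one_div, inv_mul_eq_div, one_le_div hC]; exact h3
        _ = 1 / H (2 * v₀) * 1 * H v := by ring
        _ ≤ _ := by
          have := h0 v
          gcongr
          exact one_le_pow₀ (one_le_pow₀ one_le_two)
    intro k
    induction k with
    | zero =>
      intro v hv
      by_cases hv2 : v ≤ 2 * v₀
      · exact hsmall 0 v hv hv2
      · have : 1 ≤ 1 / H (2 * v₀) := by rw [one_le_div hC]; exact h1 _
        simpa using le_mul_of_one_le_left (h0 v) this
    | succ k ih =>
      intro v hv
      by_cases hv2 : v ≤ 2 * v₀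
      · exact hsmall _ v hv hv2
      · have h3 := ih (v / 2) (by linarith)
        have h4 := (hv₁ v ((le_max_left _ _).trans hv)).1
        rw [div_lt_iff₀ (hpos v hv)] at h4
        calc H (v / 2 ^ (k + 1)) = H (v / 2 / 2 ^ k) := by rw [pow_succ']; congr 1; field_simp
          _ ≤ 1 / H (2 * v₀) * (2 ^ k) ^ q * H (v / 2) := h3
          _ ≤ 1 / H (2 * v₀) * (2 ^ k) ^ q * (2 ^ q * H v) := by gcongr
          _ = _ := by rw [pow_succ 2 k, mul_pow]; ring
  refine ⟨q, 1 / H (2 * v₀) * 2 ^ q, ?_, v₀, hv₀, fun v hv => ⟨hpos v hv, fun s hs => ?_⟩⟩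
  · have hC := hpos (2 * v₀) (by linarith)
    positivity
  obtain ⟨k, hk1, hk2⟩ := exists_nat_pow_near (x := 1 + s) (y := (2 : ℝ)) (by linarith) one_lt_two
  have hvp : 0 < v := hv₀.trans_le hv
  have hC := hpos (2 * v₀) (by linarith)
  have := h0 v
  calc H (v / (1 + s)) ≤ H (v / 2 ^ (k + 1)) := by
        refine hanti (show 0 < v / 2 ^ (k + 1) by positivity)
          (show 0 < v / (1 + s) by positivity) ?_
        gcongr
    _ ≤ 1 / H (2 * v₀) * (2 ^ (k + 1)) ^ q * H v := hdyad (k + 1) v hv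
    _ = 1 / H (2 * v₀) * 2 ^ q * (2 ^ k) ^ q * H v := by rw [pow_succ 2 k, mul_pow]; ring
    _ ≤ _ := by gcongr

/-- The probability that `V₁` and `V₂` exceed `1 - u₁` and `1 - u₂`. -/
noncomputable def tipMass {Ω : Type*} [MeasurableSpace Ω] (P : Measure Ω) (V₁ V₂ : Ω → ℝ)
    (u₁ u₂ : ℝ) : ℝ :=
  P.real {ω | 1 - u₁ < V₁ ω ∧ 1 - u₂ < V₂ ω}

/-- The probability that `min V₁ V₂` exceeds `1 - 1 / v`. -/
noncomputable def tipTail {Ω : Type*} [MeasurableSpace Ω] (P : Measure Ω) (V₁ V₂ : Ω → ℝ)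
    (v : ℝ) : ℝ :=
  tipMass P V₁ V₂ (1 / v) (1 / v)

/-- A radius `R` in the Gumbel max-domain of attraction which is independent of `(V₁, V₂)`, where
`min V₁ V₂ ≤ 1` and `(V₁, V₂)` behaves near the point `(1, 1)` as prescribed by `ξ`. -/
structure RadialModel {Ω : Type*} [MeasurableSpace Ω] (P : Measure Ω) (R V₁ V₂ : Ω → ℝ)
    (w : ℝ → ℝ) (ξ : ℝ → ℝ → ℝ → ℝ) : Prop where
  measurable_R : Measurable R
  measurable_V₁ : Measurable V₁
  measurable_V₂ : Measurable V₂
  R_pos : ∀ᵐ ω ∂P, 0 < R ω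
  indep : IndepFun R (fun ω => (V₁ ω, V₂ ω)) P
  gumbel : GumbelMDA P R w
  min_le : ∀ᵐ ω ∂P, min (V₁ ω) (V₂ ω) ≤ 1
  tendsto : ∀ δ η s : ℝ, 0 ≤ δ → 0 ≤ η → 0 < s →
    Tendsto (fun v : ℝ => tipMass P V₁ V₂ ((s - δ) / v) ((s - η) / v) / tipTail P V₁ V₂ v)
      atTop (𝓝 (ξ s δ η))
  ξ_pos : ∀ s : ℝ, 0 < s → 0 < ξ s 0 0

/-- The event that `R V₁` and `R V₂` exceed `y` by more than `δ / w` and `η / w`. -/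
def jointExcess {Ω : Type*} (R V₁ V₂ : Ω → ℝ) (y w δ η : ℝ) : Set Ω :=
  {ω | y + δ / w < R ω * V₁ ω ∧ y + η / w < R ω * V₂ ω}

/-! ### The radial model: bounds, integrability, asymptotics of the joint excess. -/

section RadialModel

variable {Ω : Type*} [MeasurableSpace Ω] {P : Measure Ω} [IsProbabilityMeasure P]
  {R V₁ V₂ : Ω → ℝ} {w : ℝ → ℝ} {ξ : ℝ → ℝ → ℝ → ℝ}

lemma tipMass_mono {u₁ u₂ u₁' u₂' : ℝ} (h₁ : u₁ ≤ u₁') (h₂ : u₂ ≤ u₂') :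
    tipMass P V₁ V₂ u₁ u₂ ≤ tipMass P V₁ V₂ u₁' u₂' :=
  measureReal_mono fun _ hω => ⟨by linarith [hω.1], by linarith [hω.2]⟩

lemma tipTail_antitoneOn : AntitoneOn (tipTail P V₁ V₂) (Ioi 0) := by
  intro v hv v' _ hvv'
  have : 1 / v' ≤ 1 / v := one_div_le_one_div_of_le hv hvv'
  exact tipMass_mono this this

lemma RadialModel.measureReal_indep_inter (h : RadialModel P R V₁ V₂ w ξ) (r₀ r₁ u₁ u₂ : ℝ) (hr : r₀ ≤ r₁) :
    P.real {ω | (r₀ < R ω ∧ R ω ≤ r₁) ∧ 1 - u₁ < V₁ ω ∧ 1 - u₂ < V₂ ω}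
      = tipMass P V₁ V₂ u₁ u₂ * (P.real {ω | r₀ < R ω} - P.real {ω | r₁ < R ω}) := by
  have h1 := h.indep.measure_inter_preimage_eq_mul (Ioc r₀ r₁) (Ioi (1 - u₁) ×ˢ Ioi (1 - u₂))
    measurableSet_Ioc (measurableSet_Ioi.prod measurableSet_Ioi)
  have h2 : P.real (R ⁻¹' Ioc r₀ r₁) = P.real {ω | r₀ < R ω} - P.real {ω | r₁ < R ω} := by
    rw [← measureReal_sdiff]
    · congr 1
      ext ω
      simp
    · exact fun ω hω => lt_of_le_of_lt hr hω
    · exact measurableSet_lt measurable_const h.measurable_R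
  rw [← h2, mul_comm]
  unfold tipMass Measure.real
  rw [← ENNReal.toReal_mul]
  exact congrArg ENNReal.toReal h1

namespace RadialModel

/-- The case `s = 2`, `δ = η = 0` of the model says that `tipTail (v / 2) / tipTail v` tends to `ξ 2
0 0 > 0`. This is all that a Potter-type bound needs. -/
lemma exists_tipTail_bound (h : RadialModel P R V₁ V₂ w ξ) :
    ∃ (q : ℕ), ∃ C > 0, ∃ v₀ > 0, ∀ v ≥ v₀, 0 < tipTail P V₁ V₂ v ∧
      ∀ s ≥ 0, tipTail P V₁ V₂ (v / (1 + s)) ≤ C * (1 + s) ^ q * tipTail P V₁ V₂ v := by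
  refine exists_le_pow_mul_of_tendsto_ratio (h.ξ_pos 2 two_pos) tipTail_antitoneOn
    (fun _ => measureReal_nonneg) (fun _ => measureReal_le_one) ?_
  have := h.tendsto 0 0 2 le_rfl le_rfl two_pos
  simp only [sub_zero] at this
  refine this.congr fun v => ?_
  rw [tipTail, tipTail, one_div_div]

lemma eventually_tipTail_pos (h : RadialModel P R V₁ V₂ w ξ) :
    ∀ᶠ v in atTop, 0 < tipTail P V₁ V₂ v := by
  obtain ⟨q, C, _, v₀, _, H⟩ := h.exists_tipTail_bound
  exact eventually_atTop.2 ⟨v₀, fun v hv => (H v hv).1⟩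

lemma ξ_nonneg (h : RadialModel P R V₁ V₂ w ξ) {δ η s : ℝ} (hδ : 0 ≤ δ) (hη : 0 ≤ η)
    (hs : 0 < s) : 0 ≤ ξ s δ η :=
  ge_of_tendsto' (h.tendsto δ η s hδ hη hs)
    fun _ => div_nonneg measureReal_nonneg measureReal_nonneg

/-- `ξ` inherits from `tipMass` that it depends only on `s - δ` and `s - η`, monotonically.
Monotonicity in `s` and invariance under a common shift of all three arguments are special cases. -/
lemma ξ_le (h : RadialModel P R V₁ V₂ w ξ) {δ η s δ' η' s' : ℝ} (hδ : 0 ≤ δ) (hη : 0 ≤ η)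
    (hs : 0 < s) (hδ' : 0 ≤ δ') (hη' : 0 ≤ η') (hs' : 0 < s')
    (h₁ : s - δ ≤ s' - δ') (h₂ : s - η ≤ s' - η') : ξ s δ η ≤ ξ s' δ' η' := by
  refine le_of_tendsto_of_tendsto (h.tendsto δ η s hδ hη hs) (h.tendsto δ' η' s' hδ' hη' hs') ?_
  filter_upwards [eventually_gt_atTop 0] with v hv
  refine div_le_div_of_nonneg_right (tipMass_mono ?_ ?_) measureReal_nonneg <;> gcongr

lemma ξ_monotoneOn (h : RadialModel P R V₁ V₂ w ξ) {δ η : ℝ} (hδ : 0 ≤ δ) (hη : 0 ≤ η) :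
    MonotoneOn (fun s => ξ s δ η) (Ioi 0) := fun s hs s' hs' hss' =>
  h.ξ_le hδ hη hs hδ hη hs' (by linarith) (by linarith)

lemma exists_ξ_le_pow (h : RadialModel P R V₁ V₂ w ξ) :
    ∃ (q : ℕ), ∃ C > 0, ∀ s > 0, ξ s 0 0 ≤ C * (1 + s) ^ q := by
  obtain ⟨q, C, hC, v₀, hv₀, H⟩ := h.exists_tipTail_bound
  refine ⟨q, C, hC, fun s hs => le_of_tendsto (h.tendsto 0 0 s le_rfl le_rfl hs) ?_⟩
  filter_upwards [eventually_ge_atTop v₀] with v hv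
  obtain ⟨h1, h2⟩ := H v hv
  have hv0 : 0 < v := hv₀.trans_le hv
  rw [div_le_iff₀ h1]
  refine le_trans ?_ (h2 s hs.le)
  have : s / v ≤ 1 / (v / (1 + s)) := by
    rw [one_div_div]
    gcongr
    linarith
  simp only [sub_zero]
  exact tipMass_mono this this

/-- Measurability comes from monotonicity in `s`; domination comes from the polynomial bound on `ξ s
0 0`. -/
lemma integrableOn_ξ (h : RadialModel P R V₁ V₂ w ξ) {δ η : ℝ} (hδ : 0 ≤ δ) (hη : 0 ≤ η) :
    IntegrableOn (fun s => ξ s δ η * Real.exp (-s)) (Ioi 0) := by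
  obtain ⟨q, C, hC, H⟩ := h.exists_ξ_le_pow
  have hint : IntegrableOn (fun s : ℝ => C * (q.factorial * 2 ^ q * Real.exp (1 / 2))
      * Real.exp (-(1 / 2) * s)) (Ioi 0) :=
    (exp_neg_integrableOn_Ioi 0 (by norm_num)).const_mul _
  refine Integrable.mono' hint ?_ ?_
  · have hm := aemeasurable_restrict_of_monotoneOn (μ := volume) measurableSet_Ioi
      (h.ξ_monotoneOn hδ hη)
    exact (hm.mul (by fun_prop)).aestronglyMeasurable
  · filter_upwards [ae_restrict_mem measurableSet_Ioi] with s hs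
    have hs0 : 0 < s := hs
    have h1 : ξ s δ η ≤ ξ s 0 0 :=
      h.ξ_le hδ hη hs le_rfl le_rfl hs (by linarith) (by linarith)
    have h2 := H s hs
    -- Half of the exponential absorbs `(1 + s)^q`, at the price of the constant `q! 2^q exp(1/2)`.
    have h3 := Real.pow_div_factorial_le_exp ((1 + s) / 2) (by positivity) q
    rw [div_le_iff₀ (by positivity), div_pow, div_le_iff₀ (by positivity)] at h3
    rw [Real.norm_of_nonneg (mul_nonneg (h.ξ_nonneg hδ hη hs) (Real.exp_pos _).le)]
    calc _ ≤ C * (Real.exp ((1 + s) / 2) * q.factorial * 2 ^ q) * Real.exp (-s) := by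
          gcongr
          exact (h1.trans h2).trans (by gcongr)
      _ = C * (q.factorial * 2 ^ q) * (Real.exp ((1 + s) / 2) * Real.exp (-s)) := by ring
      _ = C * (q.factorial * 2 ^ q) * (Real.exp (1 / 2) * Real.exp (-(1 / 2) * s)) := by
          rw [← Real.exp_add, ← Real.exp_add]
          ring_nf
      _ = _ := by ring

lemma intervalIntegrable_ξ (h : RadialModel P R V₁ V₂ w ξ) {δ η : ℝ} (hδ : 0 ≤ δ) (hη : 0 ≤ η)
    {a b : ℝ} (ha : 0 ≤ a) (hab : a ≤ b) :
    IntervalIntegrable (fun s => ξ s δ η * Real.exp (-s)) volume a b := by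
  rw [intervalIntegrable_iff_integrableOn_Ioc_of_le hab]
  exact (h.integrableOn_ξ hδ hη).mono_set fun s hs => ha.trans_lt hs.1

lemma integral_ξ_le (h : RadialModel P R V₁ V₂ w ξ) {δ η : ℝ} (hδ : 0 ≤ δ) (hη : 0 ≤ η)
    {a b : ℝ} (ha : 0 ≤ a) (hab : a ≤ b) (hb : 0 < b) :
    ∫ s in a..b, ξ s δ η * Real.exp (-s) ≤ ξ b δ η * (Real.exp (-a) - Real.exp (-b)) := by
  have h1 : ξ b δ η * (Real.exp (-a) - Real.exp (-b)) = ∫ s in a..b, ξ b δ η * Real.exp (-s) := by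
    rw [intervalIntegral.integral_const_mul, intervalIntegral.integral_comp_neg,
      integral_exp]
  rw [h1]
  refine intervalIntegral.integral_mono_on_of_le_Ioo hab (h.intervalIntegrable_ξ hδ hη ha hab)
    (Continuous.intervalIntegrable (by fun_prop) _ _) fun s hs => ?_
  gcongr
  exact h.ξ_monotoneOn hδ hη (show 0 < s from ha.trans_lt hs.1) hb hs.2.le

lemma le_integral_ξ (h : RadialModel P R V₁ V₂ w ξ) {δ η : ℝ} (hδ : 0 ≤ δ) (hη : 0 ≤ η)
    {a b : ℝ} (ha : 0 < a) (hab : a ≤ b) :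
    ξ a δ η * (Real.exp (-a) - Real.exp (-b)) ≤ ∫ s in a..b, ξ s δ η * Real.exp (-s) := by
  have h1 : ξ a δ η * (Real.exp (-a) - Real.exp (-b)) = ∫ s in a..b, ξ a δ η * Real.exp (-s) := by
    rw [intervalIntegral.integral_const_mul, intervalIntegral.integral_comp_neg,
      integral_exp]
  rw [h1]
  refine intervalIntegral.integral_mono_on_of_le_Ioo hab
    (Continuous.intervalIntegrable (by fun_prop) _ _) (h.intervalIntegrable_ξ hδ hη ha.le hab)
    fun s hs => ?_
  gcongr
  exact h.ξ_monotoneOn hδ hη ha (show 0 < s from ha.trans hs.1) hs.1.le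

lemma measurableSet_jointExcess (h : RadialModel P R V₁ V₂ w ξ) (y r δ η : ℝ) :
    MeasurableSet (jointExcess R V₁ V₂ y r δ η) :=
  (measurableSet_lt measurable_const (h.measurable_R.mul h.measurable_V₁)).inter
    (measurableSet_lt measurable_const (h.measurable_R.mul h.measurable_V₂))

lemma measureReal_jointExcess_block (h : RadialModel P R V₁ V₂ w ξ) {y r δ η r₀ r₁ : ℝ}
    (hr : r₀ ≤ r₁) :
    P.real (jointExcess R V₁ V₂ y r δ η ∩ {ω | r₀ < R ω})
      - P.real (jointExcess R V₁ V₂ y r δ η ∩ {ω | r₁ < R ω})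
      = P.real (jointExcess R V₁ V₂ y r δ η ∩ {ω | r₀ < R ω ∧ R ω ≤ r₁}) := by
  rw [← measureReal_sdiff]
  · congr 1
    ext ω
    simp only [Set.mem_sdiff, mem_inter_iff, mem_ofPred_eq, not_and, not_lt]
    tauto
  · exact inter_subset_inter_right _ fun ω hω => lt_of_le_of_lt hr hω
  · exact (h.measurableSet_jointExcess _ _ _ _).inter
      (measurableSet_lt measurable_const h.measurable_R)

/-- On a block of values of `R`, replacing `R` by the upper end of the block enlarges the event to
one on `(V₁, V₂)` alone, and independence factorises it. The lower end gives the matching bound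
`le_block`. -/
lemma block_le (h : RadialModel P R V₁ V₂ w ξ) {y δ η s₀ s₁ : ℝ} (hy : 0 < y)
    (hδ : 0 ≤ δ) (hη : 0 ≤ η) (h₀ : 0 ≤ s₀) (hs : s₀ ≤ s₁) :
    P.real (jointExcess R V₁ V₂ y (w y) δ η ∩ {ω | y + s₀ / w y < R ω})
      - P.real (jointExcess R V₁ V₂ y (w y) δ η ∩ {ω | y + s₁ / w y < R ω})
      ≤ tipMass P V₁ V₂ ((s₁ - δ) / (y * w y + s₁)) ((s₁ - η) / (y * w y + s₁)) *
        (P.real {ω | y + s₀ / w y < R ω} - P.real {ω | y + s₁ / w y < R ω}) := by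
  have hw := h.gumbel.w_pos y hy
  have hr : y + s₀ / w y ≤ y + s₁ / w y := by gcongr
  rw [h.measureReal_jointExcess_block hr, ← h.measureReal_indep_inter _ _ _ _ hr]
  have h₁ : 0 ≤ s₁ := h₀.trans hs
  have key : ∀ d r V : ℝ, 0 ≤ d → 0 < r → r ≤ y + s₁ / w y → y + d / w y < r * V →
      1 - (s₁ - d) / (y * w y + s₁) < V := by
    intro d r V hd hr0 hr1 hV
    have hV0 : 0 < V := by
      have : 0 < y + d / w y := by positivity
      exact pos_of_mul_pos_right (this.trans hV) hr0.le
    have h2 : y + d / w y < (y + s₁ / w y) * V := hV.trans_le (by gcongr)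
    have h3 : 1 - (s₁ - d) / (y * w y + s₁) = (y + d / w y) / (y + s₁ / w y) := by
      have : y * w y + s₁ ≠ 0 := by positivity
      have : y + s₁ / w y ≠ 0 := by positivity
      field_simp
      ring
    rw [h3, div_lt_iff₀ (by positivity)]
    linarith
  refine measureReal_mono ?_
  rintro ω ⟨⟨h2, h3⟩, h4⟩
  have hR : 0 < R ω := lt_of_le_of_lt (by positivity) h4.1
  exact ⟨h4, key δ _ _ hδ hR h4.2 h2, key η _ _ hη hR h4.2 h3⟩

lemma le_block (h : RadialModel P R V₁ V₂ w ξ) {y δ η s₀ s₁ : ℝ} (hy : 0 < y)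
    (hδ : 0 ≤ δ) (hη : 0 ≤ η) (h₀ : 0 ≤ s₀) (hs : s₀ ≤ s₁) :
    tipMass P V₁ V₂ ((s₀ - δ) / (y * w y + s₀)) ((s₀ - η) / (y * w y + s₀)) *
        (P.real {ω | y + s₀ / w y < R ω} - P.real {ω | y + s₁ / w y < R ω})
      ≤ P.real (jointExcess R V₁ V₂ y (w y) δ η ∩ {ω | y + s₀ / w y < R ω})
      - P.real (jointExcess R V₁ V₂ y (w y) δ η ∩ {ω | y + s₁ / w y < R ω}) := by
  have hw := h.gumbel.w_pos y hy
  have hr : y + s₀ / w y ≤ y + s₁ / w y := by gcongr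
  rw [h.measureReal_jointExcess_block hr, ← h.measureReal_indep_inter _ _ _ _ hr]
  have key : ∀ d r V : ℝ, 0 ≤ d → y + s₀ / w y < r →
      1 - (s₀ - d) / (y * w y + s₀) < V → y + d / w y < r * V := by
    intro d r V hd hr0 hV
    have h3 : 1 - (s₀ - d) / (y * w y + s₀) = (y + d / w y) / (y + s₀ / w y) := by
      have : y * w y + s₀ ≠ 0 := by positivity
      have : y + s₀ / w y ≠ 0 := by positivity
      field_simp
      ring
    rw [h3] at hV
    have hV0 : 0 < V := lt_of_le_of_lt (by positivity) hV
    rw [div_lt_iff₀ (by positivity), mul_comm] at hV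
    exact hV.trans (by gcongr)
  refine measureReal_mono ?_
  rintro ω ⟨h4, h2, h3⟩
  exact ⟨⟨key δ _ _ hδ h4.1 h2, key η _ _ hη h4.1 h3⟩, h4⟩

/-- On the dyadic block `2^k < s ≤ 2^(k+1)` the tip mass grows at most like `2^(kq)`, while the tail
of `R` decays like `2^(-k(q+1))`. The spare power makes the blocks summable, uniformly in `δ` and
`η`. -/
lemma exists_tail_jointExcess_le (h : RadialModel P R V₁ V₂ w ξ) :
    ∃ D > 0, ∀ᶠ y in atTop, ∀ δ ≥ 0, ∀ η ≥ 0, ∀ k : ℕ,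
      P.real (jointExcess R V₁ V₂ y (w y) δ η ∩ {ω | y + 2 ^ k / w y < R ω})
        ≤ D * (1 / 2) ^ k * (P.real {ω | y < R ω} * tipTail P V₁ V₂ (y * w y)) := by
  obtain ⟨q, C, hC, v₀, hv₀, H⟩ := h.exists_tipTail_bound
  obtain ⟨C', hC', y₀, hy₀, HF⟩ := h.gumbel.exists_tail_le (q + 1)
  refine ⟨2 * (C * C' * 2 ^ q), by positivity, ?_⟩
  filter_upwards [eventually_ge_atTop y₀, (h.gumbel.tendsto_mul_scaling h.measurable_R
    h.R_pos).eventually_ge_atTop v₀] with y hy hv δ hδ η hη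
  have hy0 : 0 < y := hy₀.trans_le hy
  have hw := h.gumbel.w_pos y hy0
  set T := tipTail P V₁ V₂ (y * w y) with hT
  set F := P.real {ω | y < R ω} with hF
  set D := C * C' * 2 ^ q with hD
  have hT0 : 0 < T := (H _ hv).1
  have hF0 : 0 < F := h.gumbel.infinite_endpoint y
  set e : ℕ → ℝ := fun k =>
    P.real (jointExcess R V₁ V₂ y (w y) δ η ∩ {ω | y + 2 ^ k / w y < R ω}) with he
  have hstep : ∀ k, e k - e (k + 1) ≤ D * (1 / 2) ^ k * (F * T) := by
    intro k
    have h1 := h.block_le hy0 hδ hη (s₀ := 2 ^ k) (s₁ := 2 ^ (k + 1)) (by positivity)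
      (pow_le_pow_right₀ one_le_two k.le_succ)
    have h2 : tipMass P V₁ V₂ ((2 ^ (k + 1) - δ) / (y * w y + 2 ^ (k + 1)))
        ((2 ^ (k + 1) - η) / (y * w y + 2 ^ (k + 1))) ≤ C * (1 + 2 ^ (k + 1)) ^ q * T := by
      refine le_trans ?_ ((H _ hv).2 (2 ^ (k + 1)) (by positivity))
      have h3 : ∀ d ≥ 0, ((2 : ℝ) ^ (k + 1) - d) / (y * w y + 2 ^ (k + 1))
          ≤ 1 / (y * w y / (1 + 2 ^ (k + 1))) := by
        intro d hd
        rw [one_div_div]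
        have : 0 < y * w y := by positivity
        have : (0 : ℝ) < 2 ^ (k + 1) := by positivity
        gcongr <;> linarith
      exact tipMass_mono (h3 δ hδ) (h3 η hη)
    have h4 : P.real {ω | y + 2 ^ k / w y < R ω} ≤ C' * F / (1 + 2 ^ k) ^ (q + 1) := by
      rw [le_div_iff₀ (by positivity), mul_comm]
      exact HF y hy (2 ^ k) (by positivity)
    have h5 : (1 + 2 ^ (k + 1) : ℝ) ^ q ≤ 2 ^ q * (1 + 2 ^ k) ^ q := by
      rw [← mul_pow]
      gcongr
      rw [pow_succ]
      linarith
    calc e k - e (k + 1) ≤ _ := h1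
      _ ≤ (C * (1 + 2 ^ (k + 1)) ^ q * T) * (C' * F / (1 + 2 ^ k) ^ (q + 1)) := by
          refine mul_le_mul h2 ?_ ?_ (by positivity)
          · exact (sub_le_self _ measureReal_nonneg).trans h4
          · refine sub_nonneg.2 (survivor_antitone ?_)
            gcongr
            · exact one_le_two
            · omega
      _ ≤ (C * (2 ^ q * (1 + 2 ^ k) ^ q) * T) * (C' * F / (1 + 2 ^ k) ^ (q + 1)) := by gcongr
      _ = D * (1 / (1 + 2 ^ k)) * (F * T) := by
          rw [hD, pow_succ _ q]
          field_simp
      _ ≤ D * (1 / 2) ^ k * (F * T) := by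
          rw [one_div_pow]
          gcongr
          linarith
  -- This replaces the summation: after subtracting the geometric majorant the sequence increases to
  -- `0`, hence is nowhere positive.
  have hmono : Monotone fun k => e k - 2 * D * (1 / 2) ^ k * (F * T) := by
    refine monotone_nat_of_le_succ fun k => ?_
    have := hstep k
    rw [pow_succ]
    linarith
  have hlim : Tendsto (fun k => e k - 2 * D * (1 / 2) ^ k * (F * T)) atTop (𝓝 0) := by
    have h6 : Tendsto e atTop (𝓝 0) := by
      have h7 : Tendsto (fun k : ℕ => y + 2 ^ k / w y) atTop atTop :=
        tendsto_atTop_add_const_left _ _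
          ((tendsto_pow_atTop_atTop_of_one_lt one_lt_two).atTop_div_const hw)
      exact squeeze_zero (fun _ => measureReal_nonneg)
        (fun _ => measureReal_mono inter_subset_right)
        ((tendsto_survivor_atTop h.measurable_R).comp h7)
    have h8 : Tendsto (fun k : ℕ => 2 * D * (1 / 2 : ℝ) ^ k * (F * T)) atTop (𝓝 0) := by
      simpa using ((tendsto_pow_atTop_nhds_zero_of_lt_one (r := (1 / 2 : ℝ)) (by norm_num)
        (by norm_num)).const_mul (2 * D)).mul_const (F * T)
    simpa using h6.sub h8
  intro k
  have : e k - 2 * D * (1 / 2) ^ k * (F * T) ≤ 0 := hmono.ge_of_tendsto hlim k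
  linarith

/-- Whichever of `V₁`, `V₂` is at most `1`, its own condition already forces `R > y`, so only `s >
0` contributes. -/
lemma measureReal_jointExcess_inter (h : RadialModel P R V₁ V₂ w ξ) {y δ η : ℝ} (hy : 0 < y)
    (hδ : 0 ≤ δ) (hη : 0 ≤ η) :
    P.real (jointExcess R V₁ V₂ y (w y) δ η ∩ {ω | y < R ω})
      = P.real (jointExcess R V₁ V₂ y (w y) δ η) := by
  have hw := h.gumbel.w_pos y hy
  refine measureReal_congr ?_
  filter_upwards [h.R_pos, h.min_le] with ω hR hmin
  refine propext ⟨fun hω => hω.1, fun hω => ⟨hω, ?_⟩⟩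
  have h1 : y < R ω * V₁ ω := lt_of_le_of_lt (le_add_of_nonneg_right (by positivity)) hω.1
  have h2 : y < R ω * V₂ ω := lt_of_le_of_lt (le_add_of_nonneg_right (by positivity)) hω.2
  show y < R ω
  rcases min_le_iff.1 hmin with h3 | h3
  · exact h1.trans_le (mul_le_of_le_one_right hR.le h3)
  · exact h2.trans_le (mul_le_of_le_one_right hR.le h3)

lemma tendsto_survivor_block (h : RadialModel P R V₁ V₂ w ξ) (s₀ s₁ : ℝ) :
    Tendsto (fun y => (P.real {ω | y + s₀ / w y < R ω} - P.real {ω | y + s₁ / w y < R ω}) /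
      P.real {ω | y < R ω}) atTop (𝓝 (Real.exp (-s₀) - Real.exp (-s₁))) := by
  simpa only [sub_div] using (h.gumbel.tendsto s₀).sub (h.gumbel.tendsto s₁)

/-- The blocks produce the denominator `v + s`, whereas the hypothesis on `ξ` has `v`. The
discrepancy is of order `1 / v²`, so a shift of `s` by any `θ > 0` absorbs it. -/
lemma eventually_shift_le (s d : ℝ) {θ : ℝ} (hθ : 0 < θ) :
    ∀ᶠ v : ℝ in atTop, (s - d) / (v + s) ≤ (s + θ - d) / v := by
  filter_upwards [eventually_gt_atTop 0, eventually_gt_atTop (-s),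
    eventually_ge_atTop ((-(s * (s + θ - d))) / θ)] with v h0 h1 h2
  rw [div_le_iff₀ hθ] at h2
  rw [div_le_div_iff₀ (by linarith) h0]
  nlinarith

lemma eventually_le_shift (s d : ℝ) {θ : ℝ} (hθ : 0 < θ) :
    ∀ᶠ v : ℝ in atTop, (s - θ - d) / v ≤ (s - d) / (v + s) := by
  filter_upwards [eventually_gt_atTop 0, eventually_gt_atTop (-s),
    eventually_ge_atTop ((s * (s - θ - d)) / θ)] with v h0 h1 h2
  rw [div_le_iff₀ hθ] at h2
  rw [div_le_div_iff₀ h0 (by linarith)]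
  nlinarith

/-- Asymptotics of the probability of the joint excess. -/
theorem tendsto_jointExcess (h : RadialModel P R V₁ V₂ w ξ) {δ η : ℝ} (hδ : 0 ≤ δ) (hη : 0 ≤ η) :
    Tendsto (fun y => P.real (jointExcess R V₁ V₂ y (w y) δ η) /
        (P.real {ω | y < R ω} * tipTail P V₁ V₂ (y * w y))) atTop
      (𝓝 (∫ s in Ioi 0, ξ s δ η * Real.exp (-s))) := by
  set G := ∫ s in Ioi 0, ξ s δ η * Real.exp (-s) with hG
  set f : ℝ → ℝ := fun s => ξ s δ η * Real.exp (-s) with hf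
  have hv := h.gumbel.tendsto_mul_scaling h.measurable_R h.R_pos
  have hTpos := hv.eventually h.eventually_tipTail_pos
  have hfint := h.integrableOn_ξ hδ hη
  have hexp : ∀ a θ : ℝ, Real.exp (-a) = Real.exp θ * Real.exp (-(a + θ)) := by
    intro a θ
    rw [← Real.exp_add]
    ring_nf
  refine tendsto_order.2 ⟨fun b hb => ?_, fun b hb => ?_⟩
  -- Lower bound. The block from `(i + 2)θ` to `(i + 3)θ` is paired with `ξ` at `(i + 1)θ`, one `θ`
  -- being lost to the change of denominator. Comparing it with the integral over `[iθ, (i + 1)θ]`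
  -- displaces the exponential by `2θ`.
  · obtain ⟨θ, hθb, hθ⟩ : ∃ θ : ℝ, b < Real.exp (-(2 * θ)) * G ∧ 0 < θ := by
      have hc : Tendsto (fun θ : ℝ => Real.exp (-(2 * θ)) * G) (𝓝[>] 0) (𝓝 G) := by
        have : Continuous fun θ : ℝ => Real.exp (-(2 * θ)) * G := by fun_prop
        simpa using (this.tendsto 0).mono_left nhdsWithin_le_nhds
      exact ((hc.eventually_const_lt hb).and self_mem_nhdsWithin).exists
    obtain ⟨N, hN⟩ : ∃ N : ℕ, b < Real.exp (-(2 * θ)) * ∫ s in (0 : ℝ)..N * θ, f s := by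
      have hNt : Tendsto (fun N : ℕ => (N : ℝ) * θ) atTop atTop :=
        tendsto_natCast_atTop_atTop.atTop_mul_const hθ
      have := ((intervalIntegral_tendsto_integral_Ioi 0 hfint hNt).const_mul
        (Real.exp (-(2 * θ)))).eventually_const_lt hθb
      exact this.exists
    set g : ℕ → ℝ → ℝ := fun i y =>
      (tipMass P V₁ V₂ (((i + 1) * θ - δ) / (y * w y)) (((i + 1) * θ - η) / (y * w y))
        / tipTail P V₁ V₂ (y * w y)) *
      ((P.real {ω | y + (i + 2) * θ / w y < R ω} - P.real {ω | y + (i + 3) * θ / w y < R ω}) /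
        P.real {ω | y < R ω}) with hg
    have hlim : Tendsto (fun y => ∑ i ∈ Finset.range N, g i y) atTop
        (𝓝 (∑ i ∈ Finset.range N, ξ ((i + 1) * θ) δ η *
          (Real.exp (-((i + 2) * θ)) - Real.exp (-((i + 3) * θ))))) := by
      refine tendsto_finsetSum _ fun i _ => ?_
      exact ((h.tendsto δ η ((i + 1) * θ) hδ hη (by positivity)).comp hv).mul
        (h.tendsto_survivor_block _ _)
    have hsum : Real.exp (-(2 * θ)) * ∫ s in (0 : ℝ)..N * θ, f s ≤
        ∑ i ∈ Finset.range N, ξ ((i + 1) * θ) δ η *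
          (Real.exp (-((i + 2) * θ)) - Real.exp (-((i + 3) * θ))) := by
      have hadj := intervalIntegral.sum_integral_adjacent_intervals (μ := volume) (f := f)
        (a := fun i : ℕ => (i : ℝ) * θ) (n := N) fun i _ =>
          h.intervalIntegrable_ξ hδ hη (by positivity) (by gcongr; simp)
      simp only [Nat.cast_zero, zero_mul] at hadj
      rw [← hadj, Finset.mul_sum]
      refine Finset.sum_le_sum fun i _ => ?_
      have h1 := h.integral_ξ_le hδ hη (a := i * θ) (b := (i + 1) * θ) (by positivity)
        (by gcongr; simp) (by positivity)
      have h2 := hexp (i * θ) (2 * θ)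
      have h3 := hexp ((i + 1) * θ) (2 * θ)
      have h4 : Real.exp (-(2 * θ)) * Real.exp (2 * θ) = 1 := by
        rw [← Real.exp_add]; simp
      rw [h2, h3, ← mul_sub] at h1
      push_cast
      calc _ ≤ Real.exp (-(2 * θ)) * _ := mul_le_mul_of_nonneg_left h1 (Real.exp_pos _).le
        _ = (Real.exp (-(2 * θ)) * Real.exp (2 * θ)) * (ξ ((i + 1) * θ) δ η *
          (Real.exp (-(i * θ + 2 * θ)) - Real.exp (-((i + 1) * θ + 2 * θ)))) := by ring
        _ = _ := by rw [h4, one_mul]; ring_nf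
    have hshift : ∀ᶠ y in atTop, ∀ i ∈ Finset.range N, ∀ d ∈ ({δ, η} : Finset ℝ),
        ((i + 1) * θ - d) / (y * w y) ≤ ((i + 2) * θ - d) / (y * w y + (i + 2) * θ) := by
      refine (Finset.eventually_all _).2 fun i _ => (Finset.eventually_all _).2 fun d _ => ?_
      filter_upwards [hv.eventually (eventually_le_shift ((i + 2) * θ) d hθ)] with y hy
      convert hy using 3
      ring
    filter_upwards [hlim.eventually_const_lt (hN.trans_le hsum), hshift, hTpos,
      eventually_gt_atTop 0] with y h1 h2 h3 hy
    refine h1.trans_le ?_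
    have hF := h.gumbel.infinite_endpoint y
    have hw := h.gumbel.w_pos y hy
    set e : ℕ → ℝ := fun i => P.real (jointExcess R V₁ V₂ y (w y) δ η ∩
      {ω | y + (i + 2) * θ / w y < R ω}) with he
    rw [le_div_iff₀ (by positivity), Finset.sum_mul]
    have htel := Finset.sum_range_sub' e N
    have hle : e 0 ≤ P.real (jointExcess R V₁ V₂ y (w y) δ η) :=
      measureReal_mono inter_subset_left
    have heN : 0 ≤ e N := measureReal_nonneg
    refine le_trans (Finset.sum_le_sum fun i hi => ?_) ((htel.le).trans (by linarith))
    have h4 := h.le_block hy hδ hη (s₀ := (i + 2) * θ) (s₁ := (i + 3) * θ) (by positivity)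
      (by gcongr; norm_num)
    have h5 : e (i + 1) = P.real (jointExcess R V₁ V₂ y (w y) δ η ∩
      {ω | y + (i + 3) * θ / w y < R ω}) := by
      simp only [he]
      push_cast
      ring_nf
    rw [h5]
    refine le_trans ?_ h4
    have h6 := tipMass_mono (P := P) (V₁ := V₁) (V₂ := V₂) (h2 i hi δ (by simp))
      (h2 i hi η (by simp))
    have h7 : 0 ≤ P.real {ω | y + (i + 2) * θ / w y < R ω}
        - P.real {ω | y + (i + 3) * θ / w y < R ω} := by
      refine sub_nonneg.2 (survivor_antitone ?_)
      gcongr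
      norm_num
    refine le_trans (le_of_eq ?_) (mul_le_mul_of_nonneg_right h6 h7)
    simp only [hg]
    field_simp
  -- Upper bound. The block from `iθ` to `(i + 1)θ` is paired with `ξ` at `(i + 2)θ` and compared
  -- with the integral over `[(i + 2)θ, (i + 3)θ]`, which costs `exp(2θ)`. What lies beyond `Nθ ≥
  -- 2^k` is left to the dyadic tail bound.
  · obtain ⟨D, hD, htail⟩ := h.exists_tail_jointExcess_le
    obtain ⟨θ, hθb, hθ⟩ : ∃ θ : ℝ, Real.exp (2 * θ) * G < b ∧ 0 < θ := by
      have hc : Tendsto (fun θ : ℝ => Real.exp (2 * θ) * G) (𝓝[>] 0) (𝓝 G) := by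
        have : Continuous fun θ : ℝ => Real.exp (2 * θ) * G := by fun_prop
        simpa using (this.tendsto 0).mono_left nhdsWithin_le_nhds
      exact ((hc.eventually_lt_const hb).and self_mem_nhdsWithin).exists
    obtain ⟨k, hk⟩ : ∃ k : ℕ, D * (1 / 2) ^ k < b - Real.exp (2 * θ) * G := by
      have := ((tendsto_pow_atTop_nhds_zero_of_lt_one (r := (1 / 2 : ℝ)) (by norm_num)
        (by norm_num)).const_mul D).eventually_lt_const (u := b - Real.exp (2 * θ) * G)
        (by linarith)
      exact this.exists
    obtain ⟨N, hN⟩ := exists_nat_ge (2 ^ k / θ)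
    rw [div_le_iff₀ hθ] at hN
    set g : ℕ → ℝ → ℝ := fun i y =>
      (tipMass P V₁ V₂ (((i + 2) * θ - δ) / (y * w y)) (((i + 2) * θ - η) / (y * w y))
        / tipTail P V₁ V₂ (y * w y)) *
      ((P.real {ω | y + i * θ / w y < R ω} - P.real {ω | y + (i + 1) * θ / w y < R ω}) /
        P.real {ω | y < R ω}) with hg
    have hlim : Tendsto (fun y => ∑ i ∈ Finset.range N, g i y) atTop
        (𝓝 (∑ i ∈ Finset.range N, ξ ((i + 2) * θ) δ η *
          (Real.exp (-(i * θ)) - Real.exp (-((i + 1) * θ))))) := by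
      refine tendsto_finsetSum _ fun i _ => ?_
      exact ((h.tendsto δ η ((i + 2) * θ) hδ hη (by positivity)).comp hv).mul
        (h.tendsto_survivor_block _ _)
    have hsum : ∑ i ∈ Finset.range N, ξ ((i + 2) * θ) δ η *
          (Real.exp (-(i * θ)) - Real.exp (-((i + 1) * θ))) ≤ Real.exp (2 * θ) * G := by
      have hadj := intervalIntegral.sum_integral_adjacent_intervals (μ := volume) (f := f)
        (a := fun i : ℕ => ((i : ℝ) + 2) * θ) (n := N) fun i _ =>
          h.intervalIntegrable_ξ hδ hη (by positivity) (by gcongr; simp)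
      have hle : ∫ s in (((0 : ℕ) : ℝ) + 2) * θ..((N : ℝ) + 2) * θ, f s ≤ G := by
        rw [intervalIntegral.integral_of_le (by gcongr; simp)]
        refine setIntegral_mono_set hfint ?_ ?_
        · filter_upwards [ae_restrict_mem measurableSet_Ioi] with s hs
          exact mul_nonneg (h.ξ_nonneg hδ hη hs) (Real.exp_pos _).le
        · refine LE.le.eventuallyLE fun s hs => ?_
          exact lt_of_le_of_lt (by positivity) hs.1
      refine le_trans ?_ (mul_le_mul_of_nonneg_left hle (Real.exp_pos _).le)
      rw [← hadj, Finset.mul_sum]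
      refine Finset.sum_le_sum fun i _ => ?_
      have h1 := h.le_integral_ξ hδ hη (a := (i + 2) * θ) (b := (i + 3) * θ) (by positivity)
        (by gcongr; norm_num)
      rw [hexp (i * θ) (2 * θ), hexp ((i + 1) * θ) (2 * θ)]
      push_cast
      have h2 : (i : ℝ) * θ + 2 * θ = (i + 2) * θ := by ring
      have h3 : ((i : ℝ) + 1) * θ + 2 * θ = (i + 3) * θ := by ring
      have h4 : ((i : ℝ) + 1 + 2) * θ = (i + 3) * θ := by ring
      rw [h2, h3, h4]
      calc _ = Real.exp (2 * θ) * (ξ ((i + 2) * θ) δ η *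
          (Real.exp (-((i + 2) * θ)) - Real.exp (-((i + 3) * θ)))) := by ring
        _ ≤ _ := mul_le_mul_of_nonneg_left h1 (Real.exp_pos _).le
    have hshift : ∀ᶠ y in atTop, ∀ i ∈ Finset.range N, ∀ d ∈ ({δ, η} : Finset ℝ),
        ((i + 1) * θ - d) / (y * w y + (i + 1) * θ) ≤ ((i + 2) * θ - d) / (y * w y) := by
      refine (Finset.eventually_all _).2 fun i _ => (Finset.eventually_all _).2 fun d _ => ?_
      filter_upwards [hv.eventually (eventually_shift_le ((i + 1) * θ) d hθ)] with y hy
      convert hy using 3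
      ring
    filter_upwards [hlim.eventually_lt_const (u := b - D * (1 / 2) ^ k) (by linarith), hshift,
      hTpos, eventually_gt_atTop 0, htail] with y h1 h2 h3 hy h8
    have hF := h.gumbel.infinite_endpoint y
    have hw := h.gumbel.w_pos y hy
    set e : ℕ → ℝ := fun i => P.real (jointExcess R V₁ V₂ y (w y) δ η ∩
      {ω | y + i * θ / w y < R ω}) with he
    have htel := Finset.sum_range_sub' e N
    have hle : e 0 = P.real (jointExcess R V₁ V₂ y (w y) δ η) := by
      rw [← h.measureReal_jointExcess_inter hy hδ hη]
      simp [he]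
    have heN : e N ≤ D * (1 / 2) ^ k * (P.real {ω | y < R ω} * tipTail P V₁ V₂ (y * w y)) := by
      refine le_trans (measureReal_mono (inter_subset_inter_right _ fun ω hω => ?_))
        (h8 δ hδ η hη k)
      have hω' : y + N * θ / w y < R ω := hω
      refine lt_of_le_of_lt ?_ hω'
      gcongr
    have hmain : ∑ i ∈ Finset.range N, (e i - e (i + 1)) ≤
        (∑ i ∈ Finset.range N, g i y) * (P.real {ω | y < R ω} * tipTail P V₁ V₂ (y * w y)) := by
      rw [Finset.sum_mul]
      refine Finset.sum_le_sum fun i hi => ?_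
      have h4 := h.block_le hy hδ hη (s₀ := i * θ) (s₁ := (i + 1) * θ) (by positivity)
        (by gcongr; norm_num)
      have h5 : e (i + 1) = P.real (jointExcess R V₁ V₂ y (w y) δ η ∩
        {ω | y + (i + 1) * θ / w y < R ω}) := by
        simp only [he]
        push_cast
        rfl
      rw [h5]
      refine le_trans h4 ?_
      have h6 := tipMass_mono (P := P) (V₁ := V₁) (V₂ := V₂) (h2 i hi δ (by simp))
        (h2 i hi η (by simp))
      have h7 : 0 ≤ P.real {ω | y + i * θ / w y < R ω}
          - P.real {ω | y + (i + 1) * θ / w y < R ω} := by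
        refine sub_nonneg.2 (survivor_antitone ?_)
        gcongr
        norm_num
      refine le_trans (mul_le_mul_of_nonneg_right h6 h7) (le_of_eq ?_)
      simp only [hg]
      field_simp
    rw [div_lt_iff₀ (by positivity), ← hle]
    have h9 : 0 < P.real {ω | y < R ω} * tipTail P V₁ V₂ (y * w y) := by positivity
    nlinarith

end RadialModel
end RadialModel

/-! ### From survivor functions to weak convergence. -/

section WeakConvergence

/-- Two probability measures on `[-∞, ∞]²` concentrated on `(0, ∞]²` are equal as soon as their
survivor functions agree. -/
lemma Measure.ext_of_survivor {μ ν : Measure (EReal × EReal)} [IsProbabilityMeasure μ]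
    [IsProbabilityMeasure ν] (hμ : μ (Ioi 0 ×ˢ Ioi 0) = 1) (hν : ν (Ioi 0 ×ˢ Ioi 0) = 1)
    (h : ∀ s t : ℝ, 0 ≤ s → 0 ≤ t →
      μ (Ioi (s : EReal) ×ˢ Ioi (t : EReal)) = ν (Ioi (s : EReal) ×ˢ Ioi (t : EReal))) :
    μ = ν := by
  have hpos : ∀ x y : EReal, 0 ≤ x → 0 ≤ y → μ (Ioi x ×ˢ Ioi y) = ν (Ioi x ×ˢ Ioi y) := by
    intro x y hx hy
    induction x with
    | bot => simp at hx
    | top => simp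
    | coe x =>
      induction y with
      | bot => simp at hy
      | top => simp
      | coe y => exact h x y (by exact_mod_cast hx) (by exact_mod_cast hy)
  -- Concentration on `(0, ∞]²` lets every rectangle be cut down to nonnegative corners, the only
  -- ones where the survivor functions are compared.
  have hinter : ∀ (ρ : Measure (EReal × EReal)) [IsProbabilityMeasure ρ],
      ρ (Ioi 0 ×ˢ Ioi 0) = 1 → ∀ A B : Set EReal,
      ρ (A ×ˢ B) = ρ ((A ∩ Ioi 0) ×ˢ (B ∩ Ioi 0)) := by
    intro ρ _ hρ A B
    have hm : MeasurableSet (Ioi (0 : EReal) ×ˢ Ioi (0 : EReal)) :=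
      measurableSet_Ioi.prod measurableSet_Ioi
    have hae : ∀ᵐ p ∂ρ, p ∈ Ioi (0 : EReal) ×ˢ Ioi (0 : EReal) :=
      (mem_ae_iff_prob_eq_one hm).2 hρ
    refine measure_congr ?_
    filter_upwards [hae] with p hp
    exact propext ⟨fun hq => ⟨⟨hq.1, hp.1⟩, ⟨hq.2, hp.2⟩⟩, fun hq => ⟨hq.1.1, hq.2.1⟩⟩
  set C : Set (Set EReal) := insert univ (range Ioi) with hC
  have hCI : ∀ A ∈ C, ∃ x : EReal, 0 ≤ x ∧ A ∩ Ioi 0 = Ioi x := by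
    rintro A (rfl | ⟨x, rfl⟩)
    · exact ⟨0, le_rfl, univ_inter _⟩
    · exact ⟨max x 0, le_max_right _ _, Ioi_inter_Ioi⟩
  have hspan : IsCountablySpanning C := ⟨fun _ => univ, fun _ => mem_insert _ _, iUnion_const _⟩
  have hgenC : MeasurableSpace.generateFrom C = (inferInstance : MeasurableSpace EReal) := by
    rw [hC, MeasurableSpace.generateFrom_insert_univ, BorelSpace.measurable_eq (α := EReal),
      borel_eq_generateFrom_Ioi]
  refine ext_of_generate_finite _ (generateFrom_eq_prod hgenC hgenC hspan hspan).symm ?_ ?_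
    (by simp)
  · have hpi : IsPiSystem C := isPiSystem_Ioi.insert_univ
    exact hpi.prod hpi
  · rintro _ ⟨A, hA, B, hB, rfl⟩
    obtain ⟨x, hx, hAx⟩ := hCI A hA
    obtain ⟨y, hy, hBy⟩ := hCI B hB
    simp only
    rw [hinter μ hμ, hinter ν hν, hAx, hBy]
    exact hpos x y hx hy

/-- The portmanteau theorem gives one inequality on the open quadrant. The other comes from the
closed quadrants at `(u n, v n)`, which lie inside it. One approximating sequence per point
suffices, so continuity of `S` is not needed. -/
lemma survivor_eq_of_tendsto {ι : Type*} {l : Filter ι} [l.NeBot]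
    {ν : ι → ProbabilityMeasure (EReal × EReal)} {μ : ProbabilityMeasure (EReal × EReal)}
    {S : ℝ → ℝ → ℝ} (hν : Tendsto ν l (𝓝 μ))
    (hS : ∀ s t : ℝ, 0 ≤ s → 0 ≤ t → Tendsto (fun i => (ν i : Measure (EReal × EReal))
      (Ioi (s : EReal) ×ˢ Ioi (t : EReal))) l (𝓝 (ENNReal.ofReal (S s t))))
    (hc : ∀ s t : ℝ, 0 ≤ s → 0 ≤ t → ∃ u v : ℕ → ℝ, (∀ n, s < u n) ∧ (∀ n, t < v n) ∧
      Tendsto (fun n => S (u n) (v n)) atTop (𝓝 (S s t)))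
    {s t : ℝ} (hs : 0 ≤ s) (ht : 0 ≤ t) :
    (μ : Measure (EReal × EReal)) (Ioi (s : EReal) ×ˢ Ioi (t : EReal))
      = ENNReal.ofReal (S s t) := by
  apply le_antisymm
  · have h1 := ProbabilityMeasure.le_liminf_measure_open_of_tendsto hν
      (isOpen_Ioi.prod isOpen_Ioi : IsOpen (Ioi (s : EReal) ×ˢ Ioi (t : EReal)))
    rwa [(hS s t hs ht).liminf_eq] at h1
  · obtain ⟨u, v, hu, hv, huv⟩ := hc s t hs ht
    refine le_of_tendsto' (ENNReal.tendsto_ofReal huv) fun n => ?_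
    have h1 := ProbabilityMeasure.limsup_measure_closed_le_of_tendsto hν
      (isClosed_Ici.prod isClosed_Ici : IsClosed (Ici (u n : EReal) ×ˢ Ici (v n : EReal)))
    rw [← (hS (u n) (v n) (hs.trans (hu n).le) (ht.trans (hv n).le)).limsup_eq]
    refine le_trans ?_ (h1.trans (measure_mono ?_))
    · exact limsup_le_limsup (Eventually.of_forall fun i =>
        measure_mono (prod_mono Ioi_subset_Ici_self Ioi_subset_Ici_self))
    · exact prod_mono (Ici_subset_Ioi.2 (by exact_mod_cast hu n))
        (Ici_subset_Ioi.2 (by exact_mod_cast hv n))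

/-- Pointwise convergence of survivor functions on `[0, ∞)²` to a right-continuous limit which is
`1` at the origin implies weak convergence on the compact space `[-∞, ∞]²`. -/
theorem exists_convergesInLaw_of_survivor {law : ℝ → Measure (EReal × EReal)} {S : ℝ → ℝ → ℝ}
    (hlaw : ∀ x, 0 < x → IsProbabilityMeasure (law x))
    (hS : ∀ s t : ℝ, 0 ≤ s → 0 ≤ t → Tendsto (fun x => law x
      (Ioi (s : EReal) ×ˢ Ioi (t : EReal))) atTop (𝓝 (ENNReal.ofReal (S s t))))
    (hc : ∀ s t : ℝ, 0 ≤ s → 0 ≤ t → ∃ u v : ℕ → ℝ, (∀ n, s < u n) ∧ (∀ n, t < v n) ∧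
      Tendsto (fun n => S (u n) (v n)) atTop (𝓝 (S s t)))
    (h1 : S 0 0 = 1) :
    ∃ μ : Measure (EReal × EReal), IsProbabilityMeasure μ ∧
      (∀ s t : ℝ, 0 ≤ s → 0 ≤ t →
        μ (Ioi (s : EReal) ×ˢ Ioi (t : EReal)) = ENNReal.ofReal (S s t)) ∧
      ConvergesInLaw law μ := by
  classical
  let ν : ℝ → ProbabilityMeasure (EReal × EReal) := fun x =>
    if h : 0 < x then ⟨law x, hlaw x h⟩ else ⟨Measure.dirac 0, inferInstance⟩
  have hνlaw : ∀ x, 0 < x → (ν x : Measure (EReal × EReal)) = law x := by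
    intro x hx
    simp [ν, hx]
  have hνS : ∀ s t : ℝ, 0 ≤ s → 0 ≤ t → Tendsto (fun x => (ν x : Measure (EReal × EReal))
      (Ioi (s : EReal) ×ˢ Ioi (t : EReal))) atTop (𝓝 (ENNReal.ofReal (S s t))) := by
    intro s t hs ht
    refine (hS s t hs ht).congr' ?_
    filter_upwards [eventually_gt_atTop 0] with x hx
    rw [hνlaw x hx]
  have hsurv : ∀ (U : Ultrafilter ℝ) (μ : ProbabilityMeasure (EReal × EReal)),
      (U : Filter ℝ) ≤ atTop → Tendsto ν U (𝓝 μ) → ∀ s t : ℝ, 0 ≤ s → 0 ≤ t →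
      (μ : Measure (EReal × EReal)) (Ioi (s : EReal) ×ˢ Ioi (t : EReal))
        = ENNReal.ofReal (S s t) := fun U μ hU hν s t hs ht =>
    survivor_eq_of_tendsto hν (fun s t hs ht => (hνS s t hs ht).mono_left hU) hc hs ht
  -- Compactness of the space of probability measures supplies a candidate limit along an
  -- ultrafilter finer than `atTop`.
  obtain ⟨μ, -, hμ⟩ := isCompact_univ (X := ProbabilityMeasure (EReal × EReal)).ultrafilter_le_nhds
    ((Ultrafilter.of (atTop : Filter ℝ)).map ν) (by simp)
  have hμS := hsurv _ μ (Ultrafilter.of_le _) hμ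
  refine ⟨μ, inferInstance, hμS, ν, μ, hνlaw, rfl, ?_⟩
  -- In a compact space it is enough that every cluster point is `μ`, and the survivor function
  -- determines it.
  refine tendsto_nhds_of_unique_mapClusterPt fun μ' hμ' => ?_
  obtain ⟨U, hU, hUμ⟩ := mapClusterPt_iff_ultrafilter.1 hμ'
  have hμ'S := hsurv U μ' hU hUμ
  have hone : ∀ ρ : Measure (EReal × EReal), (∀ s t : ℝ, 0 ≤ s → 0 ≤ t →
      ρ (Ioi (s : EReal) ×ˢ Ioi (t : EReal)) = ENNReal.ofReal (S s t)) →
      ρ (Ioi 0 ×ˢ Ioi 0) = 1 := by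
    intro ρ hρ
    simpa [h1] using hρ 0 0 le_rfl le_rfl
  exact Subtype.ext (Measure.ext_of_survivor (μ := (μ' : Measure (EReal × EReal)))
    (ν := (μ : Measure (EReal × EReal))) (hone _ hμ'S) (hone _ hμS)
    fun s t hs ht => (hμ'S s t hs ht).trans (hμS s t hs ht).symm)

/-- Weak convergence descends to an open subspace which carries the limit. -/
theorem ConvergesInLaw.of_map {E K : Type*} [TopologicalSpace E] [MeasurableSpace E]
    [BorelSpace E] [TopologicalSpace K] [MeasurableSpace K] [BorelSpace K]
    [HasOuterApproxClosed K] {f : E → K} (hf : IsOpenEmbedding f) {law : ℝ → Measure E}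
    {L : Measure E} [IsProbabilityMeasure L] (hlaw : ∀ x, 0 < x → IsProbabilityMeasure (law x))
    (h : ConvergesInLaw (fun x => (law x).map f) (L.map f)) : ConvergesInLaw law L := by
  classical
  obtain ⟨ν, μ, hν, hμ, hνμ⟩ := h
  have hfm : Measurable f := hf.continuous.measurable
  refine ⟨fun x => if h : 0 < x then ⟨law x, hlaw x h⟩ else ⟨L, inferInstance⟩, ⟨L, inferInstance⟩,
    fun x hx => by simp [hx], rfl, tendsto_of_forall_isOpen_le_liminf' fun G hG => ?_⟩
  -- Open sets of `E` remain open in `K`, so the portmanteau inequality for open sets transfers. No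
  -- mass escapes, since `L` already has total mass one.
  have hfG : IsOpen (f '' G) := hf.isOpenMap G hG
  have h1 := ProbabilityMeasure.le_liminf_measure_open_of_tendsto hνμ hfG
  rw [hμ, Measure.map_apply hfm hfG.measurableSet, preimage_image_eq _ hf.injective] at h1
  refine h1.trans (le_of_eq (liminf_congr ?_))
  filter_upwards [eventually_gt_atTop 0] with x hx
  rw [hν x hx, Measure.map_apply hfm hfG.measurableSet, preimage_image_eq _ hf.injective]
  simp [hx]

end WeakConvergence

/-! ### Conditional excess laws and their survivor functions. -/

section ExcessLaw

variable {Ω : Type*} [MeasurableSpace Ω] {P : Measure Ω} [IsProbabilityMeasure P]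
  {X Y : Ω → ℝ} {a : ℝ} {g : ℝ → ℝ}

lemma measurableSet_exceedance (hX : Measurable X) (hY : Measurable Y) (x : ℝ) :
    MeasurableSet (exceedance X Y a x) :=
  (measurableSet_lt measurable_const hX).inter (measurableSet_lt measurable_const hY)

lemma condReal_excess (hX : Measurable X) (hY : Measurable Y) {x s t r : ℝ} (hr : 0 < r)
    (hs : 0 ≤ s) (ht : 0 ≤ t) :
    (P[|exceedance X Y a x]).real {ω | s / r < X ω - x ∧ t / r < Y ω - a * x}
      = P.real {ω | x + s / r < X ω ∧ a * x + t / r < Y ω} / P.real (exceedance X Y a x) := by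
  rw [measureReal_def, cond_apply (measurableSet_exceedance hX hY x), ENNReal.toReal_mul,
    ENNReal.toReal_inv, ← measureReal_def, ← measureReal_def, inv_mul_eq_div]
  congr 2
  ext ω
  have h1 : 0 ≤ s / r := by positivity
  have h2 : 0 ≤ t / r := by positivity
  simp only [exceedance, mem_inter_iff, mem_ofPred_eq]
  constructor
  · rintro ⟨-, h3, h4⟩
    constructor <;> linarith
  · rintro ⟨h3, h4⟩
    refine ⟨⟨?_, ?_⟩, ?_, ?_⟩ <;> linarith

lemma isProbabilityMeasure_excessLaw (hX : Measurable X) (hY : Measurable Y) {x : ℝ}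
    (hpos : 0 < P.real (exceedance X Y a x)) : IsProbabilityMeasure (excessLaw P X Y a g x) := by
  have : IsProbabilityMeasure (P[|exceedance X Y a x]) :=
    cond_isProbabilityMeasure fun h0 => by simp [Measure.real, h0] at hpos
  exact Measure.isProbabilityMeasure_map (by fun_prop)

lemma excessLaw_survivor (hX : Measurable X) (hY : Measurable Y) {x s t : ℝ} (hg : 0 < g x)
    (hs : 0 ≤ s) (ht : 0 ≤ t) :
    excessLaw P X Y a g x (Ioi s ×ˢ Ioi t) = ENNReal.ofReal
      (P.real {ω | x + s / g x < X ω ∧ a * x + t / g x < Y ω} / P.real (exceedance X Y a x)) := by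
  rw [← condReal_excess hX hY hg hs ht, excessLaw, Measure.map_apply (by fun_prop)
    (measurableSet_Ioi.prod measurableSet_Ioi), ofReal_measureReal]
  congr 1
  ext ω
  simp only [mem_preimage, mem_prod, mem_Ioi, mem_ofPred_eq, div_lt_iff₀ hg, mul_comm]

lemma isOpenEmbedding_realProd :
    IsOpenEmbedding (fun p : ℝ × ℝ => ((p.1 : EReal), (p.2 : EReal))) :=
  EReal.isOpenEmbedding_coe.prodMap EReal.isOpenEmbedding_coe

lemma isOpenEmbedding_realProdEReal :
    IsOpenEmbedding (fun p : ℝ × EReal => ((p.1 : EReal), p.2)) :=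
  EReal.isOpenEmbedding_coe.prodMap IsOpenEmbedding.id

/-- Weak convergence of the normalised excesses, regarded as random vectors in `[-∞, ∞]²`. -/
theorem exists_convergesInLaw_excessLaw (hX : Measurable X) (hY : Measurable Y)
    {S : ℝ → ℝ → ℝ} (hg : ∀ x, 0 < x → 0 < g x)
    (hpos : ∀ x, 0 < x → 0 < P.real (exceedance X Y a x))
    (hS : ∀ s t : ℝ, 0 ≤ s → 0 ≤ t → Tendsto (fun x =>
      P.real {ω | x + s / g x < X ω ∧ a * x + t / g x < Y ω} / P.real (exceedance X Y a x))
      atTop (𝓝 (S s t)))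
    (hc : ∀ s t : ℝ, 0 ≤ s → 0 ≤ t → ∃ u v : ℕ → ℝ, (∀ n, s < u n) ∧ (∀ n, t < v n) ∧
      Tendsto (fun n => S (u n) (v n)) atTop (𝓝 (S s t)))
    (h1 : S 0 0 = 1) :
    ∃ μ : Measure (EReal × EReal), IsProbabilityMeasure μ ∧
      (∀ s t : ℝ, 0 ≤ s → 0 ≤ t →
        μ (Ioi (s : EReal) ×ˢ Ioi (t : EReal)) = ENNReal.ofReal (S s t)) ∧
      ConvergesInLaw (fun x => (excessLaw P X Y a g x).map
        fun p : ℝ × ℝ => ((p.1 : EReal), (p.2 : EReal))) μ := by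
  have hm : Measurable fun p : ℝ × ℝ => ((p.1 : EReal), (p.2 : EReal)) :=
    isOpenEmbedding_realProd.continuous.measurable
  refine exists_convergesInLaw_of_survivor (S := S) (fun x hx => ?_) (fun s t hs ht => ?_) hc h1
  · have := isProbabilityMeasure_excessLaw (g := g) hX hY (hpos x hx)
    exact Measure.isProbabilityMeasure_map hm.aemeasurable
  · refine (ENNReal.tendsto_ofReal (hS s t hs ht)).congr' ?_
    filter_upwards [eventually_gt_atTop 0] with x hx
    rw [Measure.map_apply hm (measurableSet_Ioi.prod measurableSet_Ioi),
      ← excessLaw_survivor hX hY (hg x hx) hs ht]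
    congr 1
    ext p
    simp

end ExcessLaw

lemma setIntegral_Ioi_comp_add_right (f : ℝ → ℝ) (a d : ℝ) :
    ∫ s in Ioi (a + d), f s = ∫ s in Ioi a, f (s + d) := by
  have h := (measurePreserving_add_right volume d).setIntegral_preimage_emb
    (measurableEmbedding_addRight d) f (Ioi (a + d))
  rw [← h]
  congr 2
  ext s
  simp

lemma tendsto_setIntegral_Ioi_natCast {f : ℝ → ℝ} (hf : IntegrableOn f (Ioi 0)) :
    Tendsto (fun n : ℕ => ∫ s in Ioi (n : ℝ), f s) atTop (𝓝 0) := by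
  have h := tendsto_setIntegral_of_antitone (μ := volume) (f := f) (s := fun n : ℕ => Ioi (n : ℝ))
    (fun _ => measurableSet_Ioi) (fun m n hmn => Ioi_subset_Ioi (by exact_mod_cast hmn))
    ⟨0, by simpa using hf⟩
  have hempty : ⋂ n : ℕ, Ioi (n : ℝ) = ∅ := by
    ext s
    obtain ⟨n, hn⟩ := exists_nat_ge s
    simp only [mem_iInter, mem_Ioi, mem_empty_iff_false, iff_false, not_forall, not_lt]
    exact ⟨n, hn⟩
  simpa [hempty] using h

/-! ### Positivity and ratios of joint excess probabilities. -/

namespace RadialModel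

variable {Ω : Type*} [MeasurableSpace Ω] {P : Measure Ω} [IsProbabilityMeasure P]
  {R V₁ V₂ : Ω → ℝ} {w : ℝ → ℝ} {ξ : ℝ → ℝ → ℝ → ℝ}

lemma integral_zero_pos (h : RadialModel P R V₁ V₂ w ξ) :
    0 < ∫ s in Ioi 0, ξ s 0 0 * Real.exp (-s) := by
  have hpos : ∀ s ∈ Ioi (0 : ℝ), 0 < ξ s 0 0 * Real.exp (-s) := fun s hs =>
    mul_pos (h.ξ_pos s hs) (Real.exp_pos _)
  rw [setIntegral_pos_iff_support_of_nonneg_ae _ (h.integrableOn_ξ le_rfl le_rfl)]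
  · have : Function.support (fun s => ξ s 0 0 * Real.exp (-s)) ∩ Ioi 0 = Ioi 0 :=
      inter_eq_right.2 fun s hs => (hpos s hs).ne'
    rw [this, Real.volume_Ioi]
    exact ENNReal.zero_lt_top
  · filter_upwards [ae_restrict_mem measurableSet_Ioi] with s hs using (hpos s hs).le

/-- The joint excess probabilities are positive. -/
lemma jointExcess_pos (h : RadialModel P R V₁ V₂ w ξ) {x r : ℝ} (hx : 0 < x) :
    0 < P.real (jointExcess R V₁ V₂ x r 0 0) := by
  -- With `v ≥ 2` the tip event gives `V₁, V₂ > 1/2`, so `R > 2x` is enough.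
  obtain ⟨v, hv, hv2⟩ := (h.eventually_tipTail_pos.and (eventually_ge_atTop 2)).exists
  have hF := h.gumbel.infinite_endpoint (2 * x)
  obtain ⟨r₁, hr₁, hr⟩ := (((tendsto_survivor_atTop (P := P) h.measurable_R).eventually_lt_const hF).and
    (eventually_ge_atTop (2 * x))).exists
  have h1 := h.measureReal_indep_inter (2 * x) r₁ (1 / v) (1 / v) hr
  have h2 : 0 < tipMass P V₁ V₂ (1 / v) (1 / v) *
      (P.real {ω | 2 * x < R ω} - P.real {ω | r₁ < R ω}) := mul_pos hv (by linarith)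
  rw [← h1] at h2
  have h3 : 1 / v ≤ 1 / 2 := one_div_le_one_div_of_le two_pos hv2
  have key : ∀ r V : ℝ, 2 * x < r → 1 - 1 / v < V → x < r * V := by
    intro r V hr hV
    nlinarith
  refine h2.trans_le (measureReal_mono ?_)
  rintro ω ⟨⟨h4, -⟩, h5, h6⟩
  exact ⟨by simpa using key _ _ h4 h5, by simpa using key _ _ h4 h6⟩

/-- Limit of the conditional joint excess probabilities. -/
lemma tendsto_jointExcess_ratio (h : RadialModel P R V₁ V₂ w ξ) {δ η : ℝ} (hδ : 0 ≤ δ)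
    (hη : 0 ≤ η) :
    Tendsto (fun y => P.real (jointExcess R V₁ V₂ y (w y) δ η) /
        P.real (jointExcess R V₁ V₂ y (w y) 0 0)) atTop
      (𝓝 ((∫ s in Ioi 0, ξ s δ η * Real.exp (-s)) / ∫ s in Ioi 0, ξ s 0 0 * Real.exp (-s))) := by
  have h1 := (h.tendsto_jointExcess hδ hη).div (h.tendsto_jointExcess le_rfl le_rfl)
    h.integral_zero_pos.ne'
  refine h1.congr' ?_
  have hv := h.gumbel.tendsto_mul_scaling h.measurable_R h.R_pos
  filter_upwards [hv.eventually h.eventually_tipTail_pos] with y hy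
  have hF := h.gumbel.infinite_endpoint y
  simp only [Pi.div_apply]
  rw [div_div_div_cancel_right₀ (by positivity)]

end RadialModel

/-! ### Model A: the function `J` and the limit law. -/

namespace ModelA

variable {Ω : Type*} [MeasurableSpace Ω] {P : Measure Ω} [IsProbabilityMeasure P]
  {R U₁ U₂ : Ω → ℝ} {w : ℝ → ℝ} {a : ℝ} {ξ : ℝ → ℝ → ℝ → ℝ}

/-- Dividing `U₂` by `a` moves the corner `(1, a)` to `(1, 1)`. -/
lemma radialModel (h : ModelA P R U₁ U₂ w a ξ) :
    RadialModel P R U₁ (fun ω => U₂ ω / a) w ξ where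
  measurable_R := h.measurable_R
  measurable_V₁ := h.measurable_U₁
  measurable_V₂ := h.measurable_U₂.div_const a
  R_pos := h.R_pos
  indep := h.indep.comp (φ := id) (ψ := fun p : ℝ × ℝ => (p.1, p.2 / a)) measurable_id
    (by fun_prop)
  gumbel := h.gumbel
  min_le := by
    filter_upwards [h.U₁_mem] with ω hω using (min_le_left _ _).trans hω.2
  tendsto := by
    intro δ η s hδ hη hs
    refine (h.tendsto δ η s hδ hη hs).congr fun x => ?_
    have ha := h.a_mem.1
    unfold tipTail tipMass
    congr 2
    · ext ω
      simp [lt_div_iff₀' ha]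
    · ext ω
      simp
  ξ_pos := h.ξ_pos

/-- For `s ≤ δ` the threshold for `U₁ ≤ 1` is at least `1`. This is why `J_{δ, η}` may be integrated
from `δ` or from `0` alike. -/
lemma ξ_eq_zero (h : ModelA P R U₁ U₂ w a ξ) {δ η s : ℝ} (hη : 0 ≤ η) (hs : 0 < s)
    (hsδ : s ≤ δ) : ξ s δ η = 0 := by
  refine tendsto_nhds_unique (h.tendsto δ η s (hs.le.trans hsδ) hη hs) ?_
  refine tendsto_const_nhds.congr' ?_
  filter_upwards [eventually_gt_atTop 0] with x hx
  have h0 : P.real {ω | 1 - (s - δ) / x < U₁ ω ∧ a * (1 - (s - η) / x) < U₂ ω} = 0 := by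
    rw [measureReal_eq_zero_iff]
    refine measure_mono_null (t := {ω | ¬U₁ ω ∈ Ioc (0 : ℝ) 1}) (fun ω hω hU => ?_) h.U₁_mem
    have : (s - δ) / x ≤ 0 := div_nonpos_of_nonpos_of_nonneg (by linarith) hx.le
    linarith [hω.1, hU.2]
  rw [h0, zero_div]

lemma Jint_eq (h : ModelA P R U₁ U₂ w a ξ) {δ η : ℝ} (hδ : 0 ≤ δ) (hη : 0 ≤ η) :
    Jint ξ δ η = ∫ s in Ioi 0, ξ s δ η * Real.exp (-s) := by
  refine (setIntegral_eq_of_subset_of_forall_sdiff_eq_zero measurableSet_Ioi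
    (Ioi_subset_Ioi hδ) fun s hs => ?_).symm
  rw [h.ξ_eq_zero hη hs.1 (not_lt.1 hs.2), zero_mul]

/-- Translating `s` by `d` leaves `ξ` unchanged and multiplies the exponential weight by `exp(-d)`:
lack of memory along the diagonal. Positivity and right-continuity of `J` both follow from it. -/
lemma Jint_add (h : ModelA P R U₁ U₂ w a ξ) {δ η d : ℝ} (hδ : 0 ≤ δ) (hη : 0 ≤ η) (hd : 0 ≤ d) :
    Jint ξ (δ + d) (η + d) = Real.exp (-d) * Jint ξ δ η := by
  rw [Jint, setIntegral_Ioi_comp_add_right, Jint, ← integral_const_mul]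
  refine setIntegral_congr_fun measurableSet_Ioi fun s hs => ?_
  have hs0 : 0 < s := hδ.trans_lt hs
  have hξ : ξ (s + d) (δ + d) (η + d) = ξ s δ η := by
    apply le_antisymm <;>
      exact h.radialModel.ξ_le (by positivity) (by positivity) (by positivity) (by positivity)
        (by positivity) (by positivity) (by linarith) (by linarith)
  simp only [hξ]
  rw [neg_add, Real.exp_add]
  ring

lemma Jint_anti (h : ModelA P R U₁ U₂ w a ξ) {δ η δ' η' : ℝ} (hδ : 0 ≤ δ) (hη : 0 ≤ η)
    (hδ' : δ ≤ δ') (hη' : η ≤ η') : Jint ξ δ' η' ≤ Jint ξ δ η := by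
  have h1 := h.radialModel
  rw [h.Jint_eq hδ hη, h.Jint_eq (hδ.trans hδ') (hη.trans hη')]
  refine setIntegral_mono_on (h1.integrableOn_ξ (hδ.trans hδ') (hη.trans hη'))
    (h1.integrableOn_ξ hδ hη) measurableSet_Ioi fun s hs => ?_
  gcongr
  exact h1.ξ_le (hδ.trans hδ') (hη.trans hη') hs hδ hη hs (by linarith) (by linarith)

/-- `J` is antitone in each argument, and on the diagonal it equals `exp(-m) J_{0,0}`; take `m = max
δ η`. -/
lemma Jint_pos (h : ModelA P R U₁ U₂ w a ξ) {δ η : ℝ} (hδ : 0 ≤ δ) (hη : 0 ≤ η) :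
    0 < Jint ξ δ η := by
  have h0 : 0 < Jint ξ 0 0 := by
    rw [h.Jint_eq le_rfl le_rfl]
    exact h.radialModel.integral_zero_pos
  have h1 := h.Jint_anti hδ hη (le_max_left δ η) (le_max_right δ η)
  have h2 := h.Jint_add le_rfl le_rfl (d := max δ η) (le_max_of_le_left hδ)
  rw [zero_add] at h2
  rw [h2] at h1
  exact lt_of_lt_of_le (by positivity) h1

/-- This keeps the first limit coordinate finite. `J_{n,0}` is at most the tail beyond `n` of the
integral defining `J_{0,0}`. -/
lemma tendsto_Jint_natCast (h : ModelA P R U₁ U₂ w a ξ) :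
    Tendsto (fun n : ℕ => Jint ξ n 0) atTop (𝓝 0) := by
  have h1 := h.radialModel
  have hint := h1.integrableOn_ξ le_rfl le_rfl
  refine squeeze_zero (fun n => (h.Jint_pos n.cast_nonneg le_rfl).le) (fun n => ?_)
    (tendsto_setIntegral_Ioi_natCast hint)
  have hsub : Ioi (n : ℝ) ⊆ Ioi 0 := Ioi_subset_Ioi n.cast_nonneg
  refine setIntegral_mono_on ((h1.integrableOn_ξ n.cast_nonneg le_rfl).mono_set hsub)
    (hint.mono_set hsub) measurableSet_Ioi fun s hs => ?_
  gcongr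
  have : (0 : ℝ) ≤ n := n.cast_nonneg
  exact h1.ξ_le n.cast_nonneg le_rfl (hsub hs) le_rfl le_rfl (hsub hs) (by linarith) le_rfl

/-- The normalised survivor function is right-continuous along the direction `(1, a)`. -/
lemma exists_right_approx (h : ModelA P R U₁ U₂ w a ξ) {s t : ℝ} (hs : 0 ≤ s) (ht : 0 ≤ t) :
    ∃ u v : ℕ → ℝ, (∀ n, s < u n) ∧ (∀ n, t < v n) ∧
      Tendsto (fun n => Jint ξ (u n) (v n / a) / Jint ξ 0 0) atTop
        (𝓝 (Jint ξ s (t / a) / Jint ξ 0 0)) := by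
  have ha := h.a_mem.1
  have hpos : ∀ n : ℕ, (0 : ℝ) < 1 / (n + 1) := fun n => Nat.one_div_pos_of_nat
  -- The factor `a` in the second sequence makes `s` and `t / a` move by the same amount, as
  -- `Jint_add` requires.
  refine ⟨fun n => s + 1 / (n + 1), fun n => t + a * (1 / (n + 1)), fun n => ?_, fun n => ?_, ?_⟩
  · linarith [hpos n]
  · linarith [mul_pos ha (hpos n)]
  · refine Tendsto.div_const ?_ _
    have h1 : Tendsto (fun n : ℕ => Real.exp (-(1 / ((n : ℝ) + 1))) * Jint ξ s (t / a)) atTop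
        (𝓝 (Real.exp (-0) * Jint ξ s (t / a))) :=
      ((Real.continuous_exp.tendsto _).comp tendsto_one_div_add_atTop_nhds_zero_nat.neg).mul_const _
    rw [neg_zero, Real.exp_zero, one_mul] at h1
    refine h1.congr fun n => ?_
    rw [add_div, mul_div_cancel_left₀ _ ha.ne', h.Jint_add hs (by positivity) (hpos n).le]

end ModelA

section

variable {Ω Ω₀ : Type*} [MeasurableSpace Ω] [MeasurableSpace Ω₀] {P : Measure Ω}
  [IsProbabilityMeasure P] {Q : Measure Ω₀} [IsProbabilityMeasure Q] {X Y : Ω → ℝ}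
  {R U₁ U₂ : Ω₀ → ℝ} {w : ℝ → ℝ} {a : ℝ} {ξ : ℝ → ℝ → ℝ → ℝ}

lemma ProbabilityTheory.IdentDistrib.measureReal_gt_gt {X' Y' : Ω₀ → ℝ}
    (hid : IdentDistrib (fun ω => (X ω, Y ω)) (fun ω => (X' ω, Y' ω)) P Q) (x y : ℝ) :
    P.real {ω | x < X ω ∧ y < Y ω} = Q.real {ω | x < X' ω ∧ y < Y' ω} :=
  congrArg ENNReal.toReal
    (hid.measure_mem_eq (s := Ioi x ×ˢ Ioi y) (measurableSet_Ioi.prod measurableSet_Ioi))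

namespace ModelA

lemma measureReal_excess (h : ModelA Q R U₁ U₂ w a ξ)
    (hid : IdentDistrib (fun ω => (X ω, Y ω)) (fun ω => (R ω * U₁ ω, R ω * U₂ ω)) P Q)
    (x r s t : ℝ) :
    P.real {ω | x + s / r < X ω ∧ a * x + t / r < Y ω}
      = Q.real (jointExcess R U₁ (fun ω => U₂ ω / a) x r s (t / a)) := by
  rw [hid.measureReal_gt_gt]
  have ha := h.a_mem.1
  congr 1
  ext ω
  simp only [jointExcess, mem_ofPred_eq]
  rw [mul_div_assoc', lt_div_iff₀ ha, add_mul, div_right_comm, div_mul_cancel₀ _ ha.ne', mul_comm x]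

lemma measureReal_exceedance (h : ModelA Q R U₁ U₂ w a ξ)
    (hid : IdentDistrib (fun ω => (X ω, Y ω)) (fun ω => (R ω * U₁ ω, R ω * U₂ ω)) P Q)
    (x r : ℝ) :
    P.real (exceedance X Y a x) = Q.real (jointExcess R U₁ (fun ω => U₂ ω / a) x r 0 0) := by
  have := h.measureReal_excess hid x r 0 0
  simpa [exceedance] using this

lemma tendsto_excess (h : ModelA Q R U₁ U₂ w a ξ)
    (hid : IdentDistrib (fun ω => (X ω, Y ω)) (fun ω => (R ω * U₁ ω, R ω * U₂ ω)) P Q)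
    {s t : ℝ} (hs : 0 ≤ s) (ht : 0 ≤ t) :
    Tendsto (fun x => P.real {ω | x + s / w x < X ω ∧ a * x + t / w x < Y ω} /
      P.real (exceedance X Y a x)) atTop (𝓝 (Jint ξ s (t / a) / Jint ξ 0 0)) := by
  have ha := h.a_mem.1
  have hta : 0 ≤ t / a := by positivity
  rw [h.Jint_eq hs hta, h.Jint_eq le_rfl le_rfl]
  refine (h.radialModel.tendsto_jointExcess_ratio hs hta).congr fun x => ?_
  rw [h.measureReal_excess hid, h.measureReal_exceedance hid x (w x)]

lemma exceedance_pos (h : ModelA Q R U₁ U₂ w a ξ)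
    (hid : IdentDistrib (fun ω => (X ω, Y ω)) (fun ω => (R ω * U₁ ω, R ω * U₂ ω)) P Q)
    {x : ℝ} (hx : 0 < x) : 0 < P.real (exceedance X Y a x) := by
  rw [h.measureReal_exceedance hid x 1]
  exact h.radialModel.jointExcess_pos hx

lemma exists_limit (h : ModelA Q R U₁ U₂ w a ξ) (hX : Measurable X) (hY : Measurable Y)
    (hid : IdentDistrib (fun ω => (X ω, Y ω)) (fun ω => (R ω * U₁ ω, R ω * U₂ ω)) P Q) :
    ∃ μ : Measure (EReal × EReal), IsProbabilityMeasure μ ∧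
      (∀ s t : ℝ, 0 ≤ s → 0 ≤ t → μ (Ioi (s : EReal) ×ˢ Ioi (t : EReal))
        = ENNReal.ofReal (Jint ξ s (t / a) / Jint ξ 0 0)) ∧
      ConvergesInLaw (fun x => (excessLaw P X Y a w x).map
        fun p : ℝ × ℝ => ((p.1 : EReal), (p.2 : EReal))) μ := by
  refine exists_convergesInLaw_excessLaw (S := fun s t => Jint ξ s (t / a) / Jint ξ 0 0) hX hY
    h.gumbel.w_pos (fun x hx => h.exceedance_pos hid hx)
    (fun s t hs ht => h.tendsto_excess hid hs ht) (fun s t hs ht => h.exists_right_approx hs ht) ?_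
  rw [zero_div]
  exact div_self (h.Jint_pos le_rfl le_rfl).ne'

end ModelA

end

lemma exists_map_eq_of_ae_mem_range {E K : Type*} [MeasurableSpace E] [MeasurableSpace K]
    {f : E → K} (hf : MeasurableEmbedding f) (μ : Measure K) [IsProbabilityMeasure μ]
    (h : ∀ᵐ p ∂μ, p ∈ range f) : ∃ L : Measure E, IsProbabilityMeasure L ∧ L.map f = μ := by
  have h1 : (μ.comap f).map f = μ := by
    rw [hf.map_comap, Measure.restrict_eq_self_of_ae_mem h]
  refine ⟨μ.comap f, ?_, h1⟩
  refine (Measure.isProbabilityMeasure_map_iff hf.measurable.aemeasurable).1 ?_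
  rw [h1]
  infer_instance

/-- If the masses of `(n, ∞] × (0, ∞]` vanish in the limit, so does that of `{∞} × (0, ∞]`. -/
lemma ae_fst_ne_top {μ : Measure (EReal × EReal)} [IsProbabilityMeasure μ]
    (h1 : ∀ᵐ p ∂μ, p ∈ Ioi (0 : EReal) ×ˢ Ioi (0 : EReal)) {u : ℕ → ENNReal}
    (hu : ∀ n : ℕ, μ (Ioi ((n : ℝ) : EReal) ×ˢ Ioi 0) ≤ u n) (hu0 : Tendsto u atTop (𝓝 0)) :
    ∀ᵐ p ∂μ, p.1 ≠ ⊤ := by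
  have h2 : μ ({p | p.1 = ⊤} ∩ Ioi (0 : EReal) ×ˢ Ioi (0 : EReal)) = 0 := by
    refine le_antisymm (ge_of_tendsto' hu0 fun n => (measure_mono ?_).trans (hu n)) zero_le
    rintro p ⟨hp, hp'⟩
    refine ⟨?_, hp'.2⟩
    rw [mem_Ioi, show p.1 = ⊤ from hp]
    exact EReal.coe_lt_top _
  have h3 : ∀ᵐ p ∂μ, p ∉ {p : EReal × EReal | p.1 = ⊤} ∩ Ioi (0 : EReal) ×ˢ Ioi (0 : EReal) :=
    measure_eq_zero_iff_ae_notMem.1 h2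
  filter_upwards [h1, h3] with p hp hp' htop using hp' ⟨htop, hp⟩

lemma ae_snd_ne_top {μ : Measure (EReal × EReal)} [IsProbabilityMeasure μ]
    (h1 : ∀ᵐ p ∂μ, p ∈ Ioi (0 : EReal) ×ˢ Ioi (0 : EReal)) {u : ℕ → ENNReal}
    (hu : ∀ n : ℕ, μ (Ioi 0 ×ˢ Ioi ((n : ℝ) : EReal)) ≤ u n) (hu0 : Tendsto u atTop (𝓝 0)) :
    ∀ᵐ p ∂μ, p.2 ≠ ⊤ := by
  have h2 : μ ({p | p.2 = ⊤} ∩ Ioi (0 : EReal) ×ˢ Ioi (0 : EReal)) = 0 := by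
    refine le_antisymm (ge_of_tendsto' hu0 fun n => (measure_mono ?_).trans (hu n)) zero_le
    rintro p ⟨hp, hp'⟩
    refine ⟨hp'.1, ?_⟩
    rw [mem_Ioi, show p.2 = ⊤ from hp]
    exact EReal.coe_lt_top _
  have h3 : ∀ᵐ p ∂μ, p ∉ {p : EReal × EReal | p.2 = ⊤} ∩ Ioi (0 : EReal) ×ˢ Ioi (0 : EReal) :=
    measure_eq_zero_iff_ae_notMem.1 h2
  filter_upwards [h1, h3] with p hp hp' htop using hp' ⟨htop, hp⟩

/-- The unconstrained dependence model. -/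
theorem ModelA.main {Ω Ω₀ : Type*} [MeasurableSpace Ω] [MeasurableSpace Ω₀]
    {P : Measure Ω} [IsProbabilityMeasure P] {Q : Measure Ω₀} [IsProbabilityMeasure Q]
    {X Y : Ω → ℝ} (hX : Measurable X) (hY : Measurable Y)
    {R U₁ U₂ : Ω₀ → ℝ} {w : ℝ → ℝ} {a : ℝ} {ξ : ℝ → ℝ → ℝ → ℝ}
    (h : ModelA Q R U₁ U₂ w a ξ)
    (hid : IdentDistrib (fun ω => (X ω, Y ω)) (fun ω => (R ω * U₁ ω, R ω * U₂ ω)) P Q) :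
    (∀ δ η : ℝ, 0 ≤ δ → 0 ≤ η →
      IntegrableOn (fun s => ξ s δ η * Real.exp (-s)) (Ioi δ) ∧ 0 < Jint ξ δ η) ∧
    (∀ s t : ℝ, 0 ≤ s → 0 ≤ t →
      Tendsto (fun x : ℝ => (P[|exceedance X Y a x]).real
          {ω | s / w x < X ω - x ∧ t / w x < Y ω - a * x})
        atTop (𝓝 (Jint ξ s (t / a) / Jint ξ 0 0))) ∧
    (∃ L : Measure (ℝ × EReal),
      L (Ioi 0 ×ˢ Ioi 0) = 1 ∧
      (∀ s t : ℝ, 0 ≤ s → 0 ≤ t →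
        L (Ioi s ×ˢ Ioi (t : EReal)) = ENNReal.ofReal (Jint ξ s (t / a) / Jint ξ 0 0)) ∧
      ConvergesInLaw (excessLawExt P X Y a w) L) ∧
    (Tendsto (fun t => Jint ξ 0 t) atTop (𝓝 0) →
      ∃ L : Measure (ℝ × ℝ),
        L (Ioi 0 ×ˢ Ioi 0) = 1 ∧
        (∀ s t : ℝ, 0 ≤ s → 0 ≤ t →
          L (Ioi s ×ˢ Ioi t) = ENNReal.ofReal (Jint ξ s (t / a) / Jint ξ 0 0)) ∧
        ConvergesInLaw (excessLaw P X Y a w) L) := by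
  have ha := h.a_mem.1
  have hJ0 := h.Jint_pos le_rfl le_rfl
  have hlaw : ∀ x, 0 < x → IsProbabilityMeasure (excessLaw P X Y a w x) := fun x hx =>
    isProbabilityMeasure_excessLaw hX hY (h.exceedance_pos hid hx)
  obtain ⟨μ, hμ, hμS, hconv⟩ := h.exists_limit hX hY hid
  have hone : μ (Ioi 0 ×ˢ Ioi 0) = 1 := by
    have := hμS 0 0 le_rfl le_rfl
    rw [zero_div, div_self hJ0.ne', ENNReal.ofReal_one] at this
    simpa using this
  have hae : ∀ᵐ p ∂μ, p ∈ Ioi (0 : EReal) ×ˢ Ioi (0 : EReal) :=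
    (mem_ae_iff_prob_eq_one (measurableSet_Ioi.prod measurableSet_Ioi)).2 hone
  -- The limit may charge `∞` only in its second coordinate, so it can be pulled back to `ℝ × [-∞,
  -- ∞]`; the extra hypothesis on `J_{0,t}` excludes the second atom as well.
  have hfst : ∀ᵐ p ∂μ, p.1 ≠ ⊤ := by
    refine ae_fst_ne_top hae (u := fun n => ENNReal.ofReal (Jint ξ n 0 / Jint ξ 0 0))
      (fun n => ?_) ?_
    · have := hμS n 0 n.cast_nonneg le_rfl
      rw [zero_div] at this
      exact this.le
    · simpa using ENNReal.tendsto_ofReal (h.tendsto_Jint_natCast.div_const (Jint ξ 0 0))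
  refine ⟨fun δ η hδ hη => ⟨?_, h.Jint_pos hδ hη⟩, fun s t hs ht => ?_, ?_, fun hJ => ?_⟩
  · exact (h.radialModel.integrableOn_ξ hδ hη).mono_set (Ioi_subset_Ioi hδ)
  · refine (h.tendsto_excess hid hs ht).congr' ?_
    filter_upwards [eventually_gt_atTop 0] with x hx
    rw [condReal_excess hX hY (h.gumbel.w_pos x hx) hs ht]
  · have hf := isOpenEmbedding_realProdEReal
    have hr : ∀ᵐ p ∂μ, p ∈ range (fun p : ℝ × EReal => ((p.1 : EReal), p.2)) := by
      filter_upwards [hae, hfst] with p hp hp'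
      exact ⟨(p.1.toReal, p.2), by simp [EReal.coe_toReal hp' (bot_lt_of_lt hp.1).ne']⟩
    obtain ⟨L, hL, hLμ⟩ := exists_map_eq_of_ae_mem_range hf.measurableEmbedding μ hr
    have hS : ∀ s t : ℝ, 0 ≤ s → 0 ≤ t →
        L (Ioi s ×ˢ Ioi (t : EReal)) = ENNReal.ofReal (Jint ξ s (t / a) / Jint ξ 0 0) := by
      intro s t hs ht
      rw [← hμS s t hs ht, ← hLμ, hf.measurableEmbedding.map_apply]
      congr 1
      ext p
      simp
    refine ⟨L, ?_, hS, ?_⟩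
    · have := hS 0 0 le_rfl le_rfl
      rw [zero_div, div_self hJ0.ne', ENNReal.ofReal_one] at this
      simpa using this
    · have hm : Measurable fun p : ℝ × ℝ => (p.1, (p.2 : EReal)) := by fun_prop
      refine ConvergesInLaw.of_map hf (fun x hx => ?_) ?_
      · have := hlaw x hx
        exact Measure.isProbabilityMeasure_map hm.aemeasurable
      · rw [hLμ]
        convert hconv using 2 with x
        rw [excessLawExt, Measure.map_map hf.measurableEmbedding.measurable hm]
        rfl
  · have hf := isOpenEmbedding_realProd
    have hsnd : ∀ᵐ p ∂μ, p.2 ≠ ⊤ := by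
      refine ae_snd_ne_top hae (u := fun n => ENNReal.ofReal (Jint ξ 0 (n / a) / Jint ξ 0 0))
        (fun n => (hμS 0 n le_rfl n.cast_nonneg).le) ?_
      have h1 : Tendsto (fun n : ℕ => (n : ℝ) / a) atTop atTop :=
        tendsto_natCast_atTop_atTop.atTop_div_const ha
      simpa using ENNReal.tendsto_ofReal ((hJ.comp h1).div_const (Jint ξ 0 0))
    have hr : ∀ᵐ p ∂μ, p ∈ range (fun p : ℝ × ℝ => ((p.1 : EReal), (p.2 : EReal))) := by
      filter_upwards [hae, hfst, hsnd] with p hp h1 h2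
      exact ⟨(p.1.toReal, p.2.toReal), by simp [EReal.coe_toReal h1 (bot_lt_of_lt hp.1).ne',
        EReal.coe_toReal h2 (bot_lt_of_lt hp.2).ne']⟩
    obtain ⟨L, hL, hLμ⟩ := exists_map_eq_of_ae_mem_range hf.measurableEmbedding μ hr
    have hS : ∀ s t : ℝ, 0 ≤ s → 0 ≤ t →
        L (Ioi s ×ˢ Ioi t) = ENNReal.ofReal (Jint ξ s (t / a) / Jint ξ 0 0) := by
      intro s t hs ht
      rw [← hμS s t hs ht, ← hLμ, hf.measurableEmbedding.map_apply]
      congr 1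
      ext p
      simp
    refine ⟨L, ?_, hS, ConvergesInLaw.of_map hf hlaw ?_⟩
    · have := hS 0 0 le_rfl le_rfl
      rwa [zero_div, div_self hJ0.ne', ENNReal.ofReal_one] at this
    · rwa [hLμ]

/-! ### Probabilities of short windows at a continuity point of a density. -/

section Density

variable {Ω : Type*} [MeasurableSpace Ω] {P : Measure Ω} [IsProbabilityMeasure P] {W : Ω → ℝ}
  {h : ℝ → ℝ}

/-- Bounds for the probability of a short interval near a continuity point of the density. -/
lemma eventually_measureReal_Ioo_bounds (hW : Measurable W)
    (hd : P.map W = (volume : Measure ℝ).withDensity fun x => ENNReal.ofReal (h x)) {b : ℝ}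
    (hb : ContinuousAt h b) (hb0 : 0 ≤ h b) {ε : ℝ} (hε : 0 < ε) :
    ∃ r > 0, ∀ l u : ℝ, b - r ≤ l → u ≤ b + r →
      (h b - ε) * max (u - l) 0 ≤ P.real {ω | l < W ω ∧ W ω < u} ∧
      P.real {ω | l < W ω ∧ W ω < u} ≤ (h b + ε) * max (u - l) 0 := by
  obtain ⟨r, hr, H⟩ := Metric.continuousAt_iff.1 hb ε hε
  refine ⟨r, hr, fun l u hl hu => ?_⟩
  have hmeas : P {ω | l < W ω ∧ W ω < u} = ∫⁻ x in Ioo l u, ENNReal.ofReal (h x) := by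
    rw [← withDensity_apply _ measurableSet_Ioo, ← hd, Measure.map_apply hW measurableSet_Ioo]
    rfl
  have hclose : ∀ x ∈ Ioo l u, h b - ε ≤ h x ∧ h x ≤ h b + ε := by
    intro x hx
    have h1 : dist x b < r := by
      rw [Real.dist_eq, abs_lt]
      constructor <;> linarith [hx.1, hx.2]
    have h2 := H h1
    rw [Real.dist_eq, abs_lt] at h2
    constructor <;> linarith [h2.1, h2.2]
  have hlow : ENNReal.ofReal (h b - ε) * ENNReal.ofReal (u - l)
      ≤ P {ω | l < W ω ∧ W ω < u} := by
    rw [hmeas, ← Real.volume_Ioo (a := l) (b := u), ← setLIntegral_const]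
    exact setLIntegral_mono_ae' measurableSet_Ioo
      (Eventually.of_forall fun x hx => ENNReal.ofReal_le_ofReal (hclose x hx).1)
  have hupp : P {ω | l < W ω ∧ W ω < u}
      ≤ ENNReal.ofReal (h b + ε) * ENNReal.ofReal (u - l) := by
    rw [hmeas, ← Real.volume_Ioo (a := l) (b := u), ← setLIntegral_const]
    exact setLIntegral_mono_ae' measurableSet_Ioo
      (Eventually.of_forall fun x hx => ENNReal.ofReal_le_ofReal (hclose x hx).2)
  constructor
  · have := ENNReal.toReal_mono (by finiteness) hlow
    rw [ENNReal.toReal_mul, ENNReal.toReal_ofReal', ENNReal.toReal_ofReal'] at this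
    -- `h b - ε` may be negative; `ENNReal.ofReal` truncates it to `0`, which only strengthens the
    -- lower bound.
    exact le_trans (mul_le_mul_of_nonneg_right (le_max_left _ _) (le_max_right _ _)) this
  · have := ENNReal.toReal_mono (by finiteness) hupp
    rwa [ENNReal.toReal_mul, ENNReal.toReal_ofReal (by linarith), ENNReal.toReal_ofReal'] at this

/-- The probability of a window of width of order `1 / v` at a continuity point of the density. -/
lemma tendsto_mul_measureReal_window (hW : Measurable W)
    (hd : P.map W = (volume : Measure ℝ).withDensity fun x => ENNReal.ofReal (h x)) {b : ℝ}
    (hb : ContinuousAt h b) (hb0 : 0 ≤ h b) {l u : ℝ → ℝ} {α β : ℝ}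
    (hl : Tendsto (fun v => v * (l v - b)) atTop (𝓝 α))
    (hu : Tendsto (fun v => v * (u v - b)) atTop (𝓝 β)) :
    Tendsto (fun v => v * P.real {ω | l v < W ω ∧ W ω < u v}) atTop
      (𝓝 (h b * max (β - α) 0)) := by
  have hto : ∀ {f : ℝ → ℝ} {y : ℝ}, Tendsto (fun v => v * (f v - b)) atTop (𝓝 y) →
      Tendsto f atTop (𝓝 b) := by
    intro f y hf
    have h1 := (hf.mul tendsto_inv_atTop_zero).add_const b
    rw [mul_zero, zero_add] at h1
    refine h1.congr' ?_
    filter_upwards [eventually_gt_atTop 0] with v hv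
    field_simp
    ring
  have hm : Tendsto (fun v => max (v * (u v - l v)) 0) atTop (𝓝 (max (β - α) 0)) := by
    refine Tendsto.max ?_ tendsto_const_nhds
    exact (hu.sub hl).congr fun v => by ring
  have hbounds : ∀ ε > 0, ∀ᶠ v in atTop,
      (h b - ε) * max (v * (u v - l v)) 0 ≤ v * P.real {ω | l v < W ω ∧ W ω < u v} ∧
      v * P.real {ω | l v < W ω ∧ W ω < u v} ≤ (h b + ε) * max (v * (u v - l v)) 0 := by
    intro ε hε
    obtain ⟨r, hr, H⟩ := eventually_measureReal_Ioo_bounds hW hd hb hb0 hε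
    filter_upwards [(hto hl).eventually_const_le (show b - r < b by linarith),
      (hto hu).eventually_le_const (show b < b + r by linarith), eventually_gt_atTop 0]
      with v h1 h2 hv
    obtain ⟨h3, h4⟩ := H _ _ h1 h2
    have h5 : max (v * (u v - l v)) 0 = v * max (u v - l v) 0 := by
      rw [mul_max_of_nonneg _ _ hv.le, mul_zero]
    rw [h5]
    constructor
    · nlinarith
    · nlinarith
  have hcont : ∀ σ : ℝ, Tendsto (fun ε : ℝ => (h b + σ * ε) * max (β - α) 0) (𝓝[>] 0)
      (𝓝 (h b * max (β - α) 0)) := by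
    intro σ
    have : Continuous fun ε : ℝ => (h b + σ * ε) * max (β - α) 0 := by fun_prop
    simpa using (this.tendsto 0).mono_left nhdsWithin_le_nhds
  refine tendsto_order.2 ⟨fun y hy => ?_, fun y hy => ?_⟩
  · obtain ⟨ε, h1, hε⟩ := (((hcont (-1)).eventually_const_lt hy).and self_mem_nhdsWithin).exists
    filter_upwards [hbounds ε hε, (hm.const_mul (h b + -1 * ε)).eventually_const_lt h1]
      with v h2 h3
    refine h3.trans_le (le_trans (le_of_eq (by ring)) h2.1)
  · obtain ⟨ε, h1, hε⟩ := (((hcont 1).eventually_lt_const hy).and self_mem_nhdsWithin).exists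
    filter_upwards [hbounds ε hε, (hm.const_mul (h b + 1 * ε)).eventually_lt_const h1]
      with v h2 h3
    refine lt_of_le_of_lt (h2.2.trans (le_of_eq (by ring))) h3

end Density

/-- This is the source of the exponential limit: translation by `m` pulls out `exp(-m)`, and the
remaining integral cancels in the conditional probability. -/
lemma integral_max_sub_mul_exp {m : ℝ} (hm : 0 ≤ m) :
    ∫ s in Ioi 0, max 0 (s - m) * Real.exp (-s)
      = Real.exp (-m) * ∫ s in Ioi 0, max 0 (s - 0) * Real.exp (-s) := by
  have h1 : ∫ s in Ioi 0, max 0 (s - m) * Real.exp (-s)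
      = ∫ s in Ioi (0 + m), max 0 (s - m) * Real.exp (-s) := by
    refine setIntegral_eq_of_subset_of_forall_sdiff_eq_zero measurableSet_Ioi
      (Ioi_subset_Ioi (by linarith)) fun s hs => ?_
    have : s ≤ 0 + m := not_lt.1 hs.2
    rw [max_eq_left (by linarith), zero_mul]
  rw [h1, setIntegral_Ioi_comp_add_right, ← integral_const_mul]
  congr 1
  funext s
  rw [neg_add, Real.exp_add, add_sub_cancel_right, sub_zero]
  ring

/-! ### Model B: reduction to the radial model. -/

namespace ModelB

variable {Ω : Type*} [MeasurableSpace Ω] {P : Measure Ω} [IsProbabilityMeasure P]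
  {R W I₁ I₂ : Ω → ℝ} {w : ℝ → ℝ} {a ρ aρ c ε : ℝ} {zstar zinv h : ℝ → ℝ}

lemma zinv_strictAnti (hB : ModelB P R W I₁ I₂ w a ρ aρ c ε zstar zinv h) {t t' : ℝ}
    (ht : t ∈ (fun x => ρ * x + zstar x) '' Icc (1 / aρ - ε) (1 / aρ + ε))
    (ht' : t' ∈ (fun x => ρ * x + zstar x) '' Icc (1 / aρ - ε) (1 / aρ + ε))
    (htt' : t < t') : zinv t' < zinv t := by
  obtain ⟨x, hx, rfl⟩ := ht
  obtain ⟨x', hx', rfl⟩ := ht'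
  rw [hB.zinv_left hx, hB.zinv_left hx']
  exact (hB.z_anti.lt_iff_gt hx hx').1 htt'

lemma tendsto_shift (t d : ℝ) : Tendsto (fun v : ℝ => t - d / v) atTop (𝓝 t) := by
  simpa using (tendsto_const_nhds (x := d)).div_atTop tendsto_id |>.const_sub t

lemma tendsto_mul_zinv_of_ne (hB : ModelB P R W I₁ I₂ w a ρ aρ c ε zstar zinv h) {d : ℝ}
    (hd : d ≠ 0) :
    Tendsto (fun v => v * (zinv (a / aρ - d / v) - 1 / aρ)) atTop (𝓝 (c * d)) := by
  have hc := hB.c_pos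
  rcases lt_or_gt_of_ne hd with hd | hd
  · have h1 := (hB.zinv_above.tendsto_at (show -d ∈ Ioi 0 by simpa using hd)).mul_const (c * d)
    rw [one_mul] at h1
    refine h1.congr' ?_
    filter_upwards [eventually_gt_atTop 0] with v hv
    have : c * d ≠ 0 := by have := hd.ne; positivity
    rw [neg_div, ← sub_eq_add_neg]
    field_simp
  · have h1 := (hB.zinv_below.tendsto_at (show d ∈ Ioi 0 from hd)).mul_const (c * d)
    rw [one_mul] at h1
    refine h1.congr' ?_
    filter_upwards [eventually_gt_atTop 0] with v hv
    field_simp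

lemma tendsto_zinv_of_ne (hB : ModelB P R W I₁ I₂ w a ρ aρ c ε zstar zinv h) {d : ℝ}
    (hd : d ≠ 0) : Tendsto (fun v => zinv (a / aρ - d / v)) atTop (𝓝 (1 / aρ)) := by
  have h1 := ((hB.tendsto_mul_zinv_of_ne hd).mul tendsto_inv_atTop_zero).add_const (1 / aρ)
  rw [mul_zero, zero_add] at h1
  refine h1.congr' ?_
  filter_upwards [eventually_gt_atTop 0] with v hv
  rw [mul_comm v, mul_assoc, mul_inv_cancel₀ hv.ne']
  ring

/-- The expansions concern levels strictly on either side. Monotonicity squeezes the value at the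
level itself between two limits equal to `1 / aρ`. -/
lemma zinv_center (hB : ModelB P R W I₁ I₂ w a ρ aρ c ε zstar zinv h) :
    zinv (a / aρ) = 1 / aρ := by
  have hmem := mem_of_mem_nhds hB.zinv_dom
  apply le_antisymm
  · refine ge_of_tendsto (hB.tendsto_zinv_of_ne one_ne_zero) ?_
    filter_upwards [(tendsto_shift (a / aρ) 1).eventually hB.zinv_dom, eventually_gt_atTop 0]
      with v hv hv0
    have : 0 < 1 / v := by positivity
    exact (hB.zinv_strictAnti hv hmem (by linarith)).le
  · refine le_of_tendsto (hB.tendsto_zinv_of_ne (d := -1) (by norm_num)) ?_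
    filter_upwards [(tendsto_shift (a / aρ) (-1)).eventually hB.zinv_dom, eventually_gt_atTop 0]
      with v hv hv0
    have : -1 / v < 0 := div_neg_of_neg_of_pos (by norm_num) hv0
    exact (hB.zinv_strictAnti hmem hv (by linarith)).le

/-- First-order expansion of the inverse at `a / aρ`. -/
lemma tendsto_mul_zinv (hB : ModelB P R W I₁ I₂ w a ρ aρ c ε zstar zinv h) (d : ℝ) :
    Tendsto (fun v => v * (zinv (a / aρ - d / v) - 1 / aρ)) atTop (𝓝 (c * d)) := by
  rcases eq_or_ne d 0 with rfl | hd
  · simp [hB.zinv_center]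
  · exact hB.tendsto_mul_zinv_of_ne hd

/-- Near the level `a / aρ`, exceedances of `z` are described by its local inverse. -/
lemma eventually_lt_z_iff (hB : ModelB P R W I₁ I₂ w a ρ aρ c ε zstar zinv h) (d : ℝ)
    {l : ℝ → ℝ} (hl : Tendsto l atTop (𝓝 (1 / aρ))) :
    ∀ᶠ v in atTop, ∀ x ∈ Ioo (0 : ℝ) 1, l v < x →
      (a / aρ - d / v < ρ * x + zstar x ↔ x < zinv (a / aρ - d / v)) := by
  obtain ⟨κ, hκ, hz⟩ := hB.z_away
  have hε := hB.ε_mem.1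
  filter_upwards [(tendsto_shift (a / aρ) d).eventually hB.zinv_dom,
    (tendsto_shift (a / aρ) d).eventually_const_lt hκ,
    hl.eventually_const_lt (show 1 / aρ - ε < 1 / aρ by linarith)] with v h1 h2 h3 x hx hlx
  obtain ⟨u, hu, hut⟩ := h1
  rw [← hut, hB.zinv_left hu]
  -- Points of `V` are handled by monotonicity of `z`. To the right of `V` both sides fail, because
  -- `z` stays below `κ`, which is below the level.
  by_cases hxV : x ≤ 1 / aρ + ε
  · exact hB.z_anti.lt_iff_gt hu ⟨(h3.trans hlx).le, hxV⟩
  · have h4 := hz x ⟨not_le.1 hxV, hx.2.le⟩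
    have hut' : ρ * u + zstar u = a / aρ - d / v := hut
    refine iff_of_false (fun h5 => ?_) (fun h5 => hxV (h5.le.trans hu.2))
    have h6 : ρ * u + zstar u < ρ * x + zstar x := h5
    linarith

lemma aρ_pos (hB : ModelB P R W I₁ I₂ w a ρ aρ c ε zstar zinv h) : 0 < aρ :=
  one_pos.trans hB.one_lt_aρ

/-- The asymptotics of `(W, z(W))` near the point `(1 / aρ, a / aρ)`. -/
lemma tendsto_mul_tipMass (hB : ModelB P R W I₁ I₂ w a ρ aρ c ε zstar zinv h) (s δ η : ℝ) :
    Tendsto (fun v => v * tipMass P (fun ω => aρ * W ω)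
        (fun ω => aρ / a * (ρ * W ω + zstar (W ω))) ((s - δ) / v) ((s - η) / v)) atTop
      (𝓝 (h (1 / aρ) / aρ * (c * a + 1) * max 0 (s - (c * a * η + δ) / (c * a + 1)))) := by
  have ha := hB.a_mem.1
  have haρ := hB.aρ_pos
  have hc := hB.c_pos
  -- The tip event becomes `W` between `l v` and `zinv (a / aρ - d / v)`. The scaled width tends to
  -- the positive part of `((s - δ) + c a (s - η)) / aρ`.
  set l : ℝ → ℝ := fun v => 1 / aρ - (s - δ) / aρ / v with hl
  set d := a / aρ * (s - η) with hd
  have hl1 : Tendsto (fun v => v * (l v - 1 / aρ)) atTop (𝓝 (-((s - δ) / aρ))) := by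
    refine tendsto_const_nhds.congr' ?_
    filter_upwards [eventually_gt_atTop 0] with v hv
    simp only [hl]
    field_simp
    ring
  have h1 := tendsto_mul_measureReal_window hB.measurable_W hB.h_density hB.h_cont hB.h_pos.le hl1
    (hB.tendsto_mul_zinv d)
  have hval : h (1 / aρ) / aρ * (c * a + 1) * max 0 (s - (c * a * η + δ) / (c * a + 1))
      = h (1 / aρ) * max (c * d - -((s - δ) / aρ)) 0 := by
    have hpos : 0 ≤ (c * a + 1) / aρ := by positivity
    have : c * d - -((s - δ) / aρ)
        = (c * a + 1) / aρ * (s - (c * a * η + δ) / (c * a + 1)) := by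
      rw [hd]
      field_simp
      ring
    rw [this, max_comm, ← mul_zero ((c * a + 1) / aρ), ← mul_max_of_nonneg _ _ hpos]
    simp only [mul_zero]
    ring
  rw [hval]
  refine h1.congr' ?_
  filter_upwards [hB.eventually_lt_z_iff d (tendsto_shift (1 / aρ) ((s - δ) / aρ))] with v hv
  congr 1
  refine measureReal_congr ?_
  filter_upwards [hB.W_mem] with ω hω
  have e1 : (l v < W ω) ↔ (1 - (s - δ) / v < aρ * W ω) := by
    have : l v = (1 - (s - δ) / v) / aρ := by simp only [hl]; ring
    rw [this, div_lt_iff₀' haρ]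
  have e2 : (a / aρ - d / v < ρ * W ω + zstar (W ω)) ↔
      (1 - (s - η) / v < aρ / a * (ρ * W ω + zstar (W ω))) := by
    have : a / aρ - d / v = (1 - (s - η) / v) / (aρ / a) := by rw [hd]; field_simp
    rw [this, div_lt_iff₀' (by positivity)]
  refine propext ⟨fun hx => ⟨e1.1 hx.1, e2.1 ((hv _ hω hx.1).2 hx.2)⟩,
    fun hx => ⟨e1.2 hx.1, (hv _ hω (e1.2 hx.1)).1 (e2.2 hx.2)⟩⟩

lemma tendsto_mul_tipTail (hB : ModelB P R W I₁ I₂ w a ρ aρ c ε zstar zinv h) :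
    Tendsto (fun v => v * tipTail P (fun ω => aρ * W ω)
        (fun ω => aρ / a * (ρ * W ω + zstar (W ω))) v) atTop
      (𝓝 (h (1 / aρ) / aρ * (c * a + 1))) := by
  have := hB.tendsto_mul_tipMass 1 0 0
  simp only [sub_zero, mul_zero, add_zero, zero_div, max_eq_right zero_le_one, mul_one] at this
  exact this

lemma tipTail_const_pos (hB : ModelB P R W I₁ I₂ w a ρ aρ c ε zstar zinv h) :
    0 < h (1 / aρ) / aρ * (c * a + 1) := by
  have ha := hB.a_mem.1
  have haρ := hB.aρ_pos
  have hc := hB.c_pos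
  have hh := hB.h_pos
  positivity

/-- The factors `aρ` and `aρ / a` move the point `(1 / aρ, a / aρ)` to `(1, 1)`. The level for the
radial model is then `aρ x`, whence the scaling `w (aρ x)`. For `W` to the left of `1 / aρ` the
first coordinate is at most `1`; to the right the second one is, by `z_le`. -/
lemma radialModel (hB : ModelB P R W I₁ I₂ w a ρ aρ c ε zstar zinv h) :
    RadialModel P R (fun ω => aρ * W ω) (fun ω => aρ / a * (ρ * W ω + zstar (W ω))) w
      (fun s δ η => max 0 (s - (c * a * η + δ) / (c * a + 1))) where
  measurable_R := hB.measurable_R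
  measurable_V₁ := hB.measurable_W.const_mul aρ
  measurable_V₂ := ((hB.measurable_W.const_mul ρ).add
    (hB.measurable_zstar.comp hB.measurable_W)).const_mul _
  R_pos := hB.R_pos
  indep := hB.indep_RW.comp (φ := id)
    (ψ := fun x : ℝ => (aρ * x, aρ / a * (ρ * x + zstar x))) measurable_id
    (by have := hB.measurable_zstar; fun_prop)
  gumbel := hB.gumbel
  min_le := by
    have ha := hB.a_mem.1
    have haρ := hB.aρ_pos
    filter_upwards [hB.W_mem] with ω hω
    by_cases hle : W ω ≤ 1 / aρ
    · refine (min_le_left _ _).trans ?_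
      rwa [le_div_iff₀' haρ] at hle
    · refine (min_le_right _ _).trans ?_
      have := hB.z_le (W ω) ⟨not_le.1 hle, hω.2.le⟩
      calc aρ / a * (ρ * W ω + zstar (W ω)) ≤ aρ / a * (a / aρ) := by gcongr
        _ = 1 := by field_simp
  tendsto := by
    intro δ η s _ _ _
    have h0 := hB.tipTail_const_pos
    have h1 := (hB.tendsto_mul_tipMass s δ η).div hB.tendsto_mul_tipTail h0.ne'
    rw [mul_div_cancel_left₀ _ h0.ne'] at h1
    refine h1.congr' ?_
    filter_upwards [eventually_gt_atTop 0] with v hv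
    simp only [Pi.div_apply]
    rw [mul_div_mul_left _ _ hv.ne']
  ξ_pos := by
    intro s hs
    simpa using hs

end ModelB

lemma expMeasure_Ioi {r s : ℝ} (hr : 0 < r) (hs : 0 ≤ s) :
    expMeasure r (Ioi s) = ENNReal.ofReal (Real.exp (-(r * s))) := by
  have := isProbabilityMeasure_expMeasure hr
  have h1 := cdf_expMeasure_eq hr s
  rw [if_pos hs, cdf_eq_real] at h1
  rw [← ofReal_measureReal, ← compl_Iic, probReal_compl_eq_one_sub measurableSet_Iic, h1,
    sub_sub_cancel]

/-! ### Model B: the signs and the exponential limit. -/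

namespace ModelB

variable {Ω : Type*} [MeasurableSpace Ω] {P : Measure Ω} [IsProbabilityMeasure P]
  {R W I₁ I₂ : Ω → ℝ} {w : ℝ → ℝ} {a ρ aρ c ε : ℝ} {zstar zinv h : ℝ → ℝ}

/-- The limiting conditional survivor function. -/
lemma integral_ratio (hB : ModelB P R W I₁ I₂ w a ρ aρ c ε zstar zinv h) {δ η : ℝ}
    (hδ : 0 ≤ δ) (hη : 0 ≤ η) :
    (∫ s in Ioi 0, max 0 (s - (c * a * η + δ) / (c * a + 1)) * Real.exp (-s)) /
      (∫ s in Ioi 0, max 0 (s - (c * a * 0 + 0) / (c * a + 1)) * Real.exp (-s))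
      = Real.exp (-((c * a * η + δ) / (c * a + 1))) := by
  have ha := hB.a_mem.1
  have hc := hB.c_pos
  have h0 := hB.radialModel.integral_zero_pos
  rw [div_eq_iff h0.ne', integral_max_sub_mul_exp (by positivity)]
  simp

/-- The event that both components exceed `u₁` and `u₂`. -/
def jointEvent {Ω : Type*} (R W I₁ I₂ : Ω → ℝ) (ρ : ℝ) (zstar : ℝ → ℝ) (u₁ u₂ : ℝ) : Set Ω :=
  {ω | u₁ < R ω * I₁ ω * W ω ∧ u₂ < ρ * R ω * I₁ ω * W ω + R ω * I₂ ω * zstar (W ω)}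

/-- The signs contribute a constant factor, which cancels in the conditional law. -/
lemma measureReal_signs_inter (hB : ModelB P R W I₁ I₂ w a ρ aρ c ε zstar zinv h)
    (y r δ η : ℝ) :
    P.real ({ω | I₁ ω = 1 ∧ I₂ ω = 1} ∩ jointExcess R (fun ω => aρ * W ω)
        (fun ω => aρ / a * (ρ * W ω + zstar (W ω))) y r δ η)
      = P.real {ω | I₁ ω = 1 ∧ I₂ ω = 1} * P.real (jointExcess R (fun ω => aρ * W ω)
        (fun ω => aρ / a * (ρ * W ω + zstar (W ω))) y r δ η) := by
  have hz := hB.measurable_zstar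
  have hm₁ : Measurable fun p : ℝ × ℝ => p.1 * (aρ * p.2) := by fun_prop
  have hm₂ : Measurable fun p : ℝ × ℝ => p.1 * (aρ / a * (ρ * p.2 + zstar p.2)) := by fun_prop
  have h1 := hB.indep_I.measure_inter_preimage_eq_mul ({1} ×ˢ {1})
    {p : ℝ × ℝ | y + δ / r < p.1 * (aρ * p.2) ∧
      y + η / r < p.1 * (aρ / a * (ρ * p.2 + zstar p.2))}
    ((measurableSet_singleton 1).prod (measurableSet_singleton 1))
    ((measurableSet_lt measurable_const hm₁).inter (measurableSet_lt measurable_const hm₂))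
  have h2 := congrArg ENNReal.toReal h1
  rw [ENNReal.toReal_mul] at h2
  exact h2

lemma jointExcess_iff (hB : ModelB P R W I₁ I₂ w a ρ aρ c ε zstar zinv h) (x r s t : ℝ) (ω : Ω) :
    ω ∈ jointExcess R (fun ω => aρ * W ω) (fun ω => aρ / a * (ρ * W ω + zstar (W ω)))
      (aρ * x) r (aρ * s) (aρ / a * t) ↔
    x + s / r < R ω * W ω ∧ a * x + t / r < R ω * (ρ * W ω + zstar (W ω)) := by
  have ha := hB.a_mem.1
  have haρ := hB.aρ_pos
  have haa : 0 < aρ / a := by positivity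
  simp only [jointExcess, mem_ofPred_eq]
  refine and_congr ?_ ?_
  · rw [show aρ * x + aρ * s / r = aρ * (x + s / r) by ring,
      show R ω * (aρ * W ω) = aρ * (R ω * W ω) by ring, mul_lt_mul_iff_right₀ haρ]
  · rw [show aρ * x + aρ / a * t / r = aρ / a * (a * x + t / r) by field_simp,
      show R ω * (aρ / a * (ρ * W ω + zstar (W ω)))
        = aρ / a * (R ω * (ρ * W ω + zstar (W ω))) by ring, mul_lt_mul_iff_right₀ haa]

lemma le_measureReal_jointEvent (hB : ModelB P R W I₁ I₂ w a ρ aρ c ε zstar zinv h)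
    (x r s t : ℝ) :
    P.real {ω | I₁ ω = 1 ∧ I₂ ω = 1} * P.real (jointExcess R (fun ω => aρ * W ω)
        (fun ω => aρ / a * (ρ * W ω + zstar (W ω))) (aρ * x) r (aρ * s) (aρ / a * t))
      ≤ P.real (jointEvent R W I₁ I₂ ρ zstar (x + s / r) (a * x + t / r)) := by
  rw [← hB.measureReal_signs_inter]
  refine measureReal_mono ?_
  rintro ω ⟨⟨h1, h2⟩, hω⟩
  rw [hB.jointExcess_iff] at hω
  simp only [jointEvent, mem_ofPred_eq, h1, h2]
  refine ⟨by linarith [hω.1], by linarith [hω.2]⟩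

/-- Outside the event `I₁ = I₂ = 1` the joint event forces `R` to be large. -/
lemma measureReal_jointEvent_le (hB : ModelB P R W I₁ I₂ w a ρ aρ c ε zstar zinv h)
    {x r s t : ℝ} (hx : 0 < x) (hr : 0 < r) (hs : 0 ≤ s) (ht : 0 ≤ t) :
    P.real (jointEvent R W I₁ I₂ ρ zstar (x + s / r) (a * x + t / r))
      ≤ P.real {ω | I₁ ω = 1 ∧ I₂ ω = 1} * P.real (jointExcess R (fun ω => aρ * W ω)
        (fun ω => aρ / a * (ρ * W ω + zstar (W ω))) (aρ * x) r (aρ * s) (aρ / a * t))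
      + P.real {ω | aρ * x + (a - aρ * |ρ|) * x < R ω} := by
  rw [← hB.measureReal_signs_inter]
  refine le_trans ?_ (measureReal_union_le _ _)
  refine ENNReal.toReal_mono (measure_ne_top _ _) (measure_mono_ae ?_)
  filter_upwards [hB.R_pos, hB.W_mem, hB.I₁_sign, hB.I₂_sign] with ω hR hW hI₁ hI₂ hω
  have hst : 0 < x + s / r := by positivity
  have hω1 : x + s / r < R ω * I₁ ω * W ω := hω.1
  have hω2 : a * x + t / r < ρ * R ω * I₁ ω * W ω + R ω * I₂ ω * zstar (W ω) := hω.2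
  have hRW : 0 < R ω * W ω := mul_pos hR hW.1
  -- `I₁ = -1` makes the first component negative, which is impossible.
  rcases hI₁ with h1 | h1
  · rw [h1] at hω1
    nlinarith
  · rw [h1] at hω1 hω2
    rcases hI₂ with h2 | h2
    -- With `I₂ = -1` and `zstar ≥ 0` the second condition leaves `a x < |ρ| R`. The margin is
    -- chosen so that `|ρ| (aρ + (a - aρ |ρ|)) ≤ a` follows from `|ρ| < 1`; this avoids dividing by
    -- `ρ`, which may be `0`.
    · right
      show aρ * x + (a - aρ * |ρ|) * x < R ω
      rw [h2] at hω2
      have hz := (hB.zstar_mem (W ω) ⟨hW.1.le, hW.2.le⟩).1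
      have hRz : 0 ≤ R ω * zstar (W ω) := mul_nonneg hR.le hz
      have htr : 0 ≤ t / r := by positivity
      have h3 : a * x < |ρ| * R ω := by
        have h4 : ρ * (R ω * W ω) ≤ |ρ| * (R ω * W ω) :=
          mul_le_mul_of_nonneg_right (le_abs_self ρ) hRW.le
        have h5 : |ρ| * (R ω * W ω) ≤ |ρ| * R ω := by
          gcongr
          exact mul_le_of_le_one_right hR.le hW.2.le
        nlinarith
      have hρ : |ρ| < 1 := abs_lt.2 hB.ρ_mem
      have hm : 0 < a - aρ * |ρ| := by linarith [hB.aρ_lt]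
      have h6 : |ρ| * (aρ * x + (a - aρ * |ρ|) * x) ≤ a * x := by
        have : |ρ| * ((a - aρ * |ρ|) * x) ≤ (a - aρ * |ρ|) * x :=
          mul_le_of_le_one_left (by positivity) hρ.le
        nlinarith
      exact lt_of_mul_lt_mul_left (h6.trans_lt h3) (abs_nonneg ρ)
    · left
      refine ⟨⟨h1, h2⟩, ?_⟩
      rw [hB.jointExcess_iff]
      rw [h2] at hω2
      exact ⟨by linarith, by linarith⟩

/-- The normalisation of the joint excess probabilities. -/
noncomputable def normalisation {Ω : Type*} [MeasurableSpace Ω] (P : Measure Ω) (R W : Ω → ℝ)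
    (w : ℝ → ℝ) (a ρ aρ : ℝ) (zstar : ℝ → ℝ) (y : ℝ) : ℝ :=
  P.real {ω | y < R ω} * tipTail P (fun ω => aρ * W ω)
    (fun ω => aρ / a * (ρ * W ω + zstar (W ω))) (y * w y)

/-- The tail of `R` at a larger multiple of the level is negligible. -/
lemma tendsto_tail_div_normalisation (hB : ModelB P R W I₁ I₂ w a ρ aρ c ε zstar zinv h)
    {m : ℝ} (hm : 0 < m) :
    Tendsto (fun y => P.real {ω | y + m * y < R ω} / normalisation P R W w a ρ aρ zstar y)
      atTop (𝓝 0) := by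
  -- Order two suffices: `tipTail` is of exact order `1 / (y w(y))`, so one power remains and tends
  -- to zero.
  obtain ⟨C, hC, y₀, hy₀, H⟩ := hB.gumbel.exists_tail_le 2
  have hv := hB.gumbel.tendsto_mul_scaling hB.measurable_R hB.R_pos
  have hT := hB.tendsto_mul_tipTail
  have hlim : Tendsto (fun v => C / m ^ 2 / (v * (v * tipTail P (fun ω => aρ * W ω)
      (fun ω => aρ / a * (ρ * W ω + zstar (W ω))) v))) atTop (𝓝 0) :=
    tendsto_const_nhds.div_atTop (tendsto_id.atTop_mul_pos hB.tipTail_const_pos hT)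
  refine squeeze_zero' ?_ ?_ (hlim.comp hv)
  · exact Eventually.of_forall fun y => div_nonneg measureReal_nonneg
      (mul_nonneg measureReal_nonneg measureReal_nonneg)
  · filter_upwards [eventually_ge_atTop y₀,
      hv.eventually hB.radialModel.eventually_tipTail_pos] with y hy hpos
    have hy0 : 0 < y := hy₀.trans_le hy
    have hw := hB.gumbel.w_pos y hy0
    have hF := hB.gumbel.infinite_endpoint y
    have h1 := H y hy (m * (y * w y)) (by positivity)
    have h2 : m * (y * w y) / w y = m * y := by field_simp
    rw [h2] at h1
    have h3 : (m * (y * w y)) ^ 2 * P.real {ω | y + m * y < R ω} ≤ C * P.real {ω | y < R ω} := by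
      refine le_trans ?_ h1
      gcongr
      linarith
    simp only [Function.comp, normalisation]
    set T := tipTail P (fun ω => aρ * W ω) (fun ω => aρ / a * (ρ * W ω + zstar (W ω))) (y * w y)
    rw [div_le_iff₀ (by positivity)]
    have h4 : C / m ^ 2 / (y * w y * (y * w y * T)) * (P.real {ω | y < R ω} * T)
        = C * P.real {ω | y < R ω} / (m * (y * w y)) ^ 2 := by
      field_simp
    rw [h4, le_div_iff₀ (by positivity), mul_comm]
    exact h3

lemma tendsto_jointEvent (hB : ModelB P R W I₁ I₂ w a ρ aρ c ε zstar zinv h) {s t : ℝ}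
    (hs : 0 ≤ s) (ht : 0 ≤ t) :
    Tendsto (fun x => P.real (jointEvent R W I₁ I₂ ρ zstar (x + s / w (aρ * x))
        (a * x + t / w (aρ * x))) / normalisation P R W w a ρ aρ zstar (aρ * x)) atTop
      (𝓝 (P.real {ω | I₁ ω = 1 ∧ I₂ ω = 1} * ∫ u in Ioi 0,
        max 0 (u - (c * a * (aρ / a * t) + aρ * s) / (c * a + 1)) * Real.exp (-u))) := by
  have ha := hB.a_mem.1
  have haρ := hB.aρ_pos
  set p := P.real {ω | I₁ ω = 1 ∧ I₂ ω = 1}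
  have hx : Tendsto (fun x => aρ * x) atTop atTop := tendsto_id.const_mul_atTop haρ
  have h1 := ((hB.radialModel.tendsto_jointExcess (δ := aρ * s) (η := aρ / a * t) (by positivity)
    (by positivity)).comp hx).const_mul p
  have hm : 0 < (a - aρ * |ρ|) / aρ := div_pos (by linarith [hB.aρ_lt]) haρ
  have h2 := h1.add ((hB.tendsto_tail_div_normalisation hm).comp hx)
  rw [add_zero] at h2
  refine tendsto_of_tendsto_of_tendsto_of_le_of_le' h1 h2 ?_ ?_
  · filter_upwards with x
    simp only [Function.comp]
    rw [mul_div_assoc']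
    exact div_le_div_of_nonneg_right (hB.le_measureReal_jointEvent x _ s t)
      (mul_nonneg measureReal_nonneg measureReal_nonneg)
  · filter_upwards [eventually_gt_atTop 0] with x hx0
    have hw := hB.gumbel.w_pos (aρ * x) (by positivity)
    have h3 := hB.measureReal_jointEvent_le hx0 hw hs ht
    have h4 : (a - aρ * |ρ|) / aρ * (aρ * x) = (a - aρ * |ρ|) * x := by field_simp
    simp only [Function.comp, h4]
    rw [mul_div_assoc']
    refine (div_le_div_of_nonneg_right h3
      (mul_nonneg measureReal_nonneg measureReal_nonneg)).trans_eq ?_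
    rw [add_div]
    rfl

/-- With `δ = aρ s` and `η = aρ t / a` the exponent `(c a η + δ) / (c a + 1)` is linear in `s` and
`t` without a cross term, so the limit factorises. -/
lemma tendsto_jointEvent_ratio (hB : ModelB P R W I₁ I₂ w a ρ aρ c ε zstar zinv h) {s t : ℝ}
    (hs : 0 ≤ s) (ht : 0 ≤ t) :
    Tendsto (fun x => P.real (jointEvent R W I₁ I₂ ρ zstar (x + s / w (aρ * x))
        (a * x + t / w (aρ * x))) / P.real (jointEvent R W I₁ I₂ ρ zstar x (a * x))) atTop
      (𝓝 (Real.exp (-(aρ / (c * a + 1) * s)) * Real.exp (-(aρ * c / (c * a + 1) * t)))) := by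
  have ha := hB.a_mem.1
  have haρ := hB.aρ_pos
  have hc := hB.c_pos
  have h0 := hB.tendsto_jointEvent le_rfl le_rfl
  have hpos := hB.radialModel.integral_zero_pos
  simp only [zero_div, add_zero, mul_zero] at h0 hpos
  have h1 := (hB.tendsto_jointEvent hs ht).div h0 (mul_pos hB.I_pos hpos).ne'
  have h2 := hB.integral_ratio (δ := aρ * s) (η := aρ / a * t) (by positivity) (by positivity)
  simp only [mul_zero, add_zero, zero_div] at h2
  rw [mul_div_mul_left _ _ hB.I_pos.ne', h2] at h1
  have h3 : Real.exp (-((c * a * (aρ / a * t) + aρ * s) / (c * a + 1)))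
      = Real.exp (-(aρ / (c * a + 1) * s)) * Real.exp (-(aρ * c / (c * a + 1) * t)) := by
    rw [← Real.exp_add]
    congr 1
    field_simp
    ring
  rw [h3] at h1
  refine h1.congr' ?_
  have hx : Tendsto (fun x => aρ * x) atTop atTop := tendsto_id.const_mul_atTop haρ
  have hv := hB.gumbel.tendsto_mul_scaling hB.measurable_R hB.R_pos
  filter_upwards [(hv.comp hx).eventually hB.radialModel.eventually_tipTail_pos] with x hT
  have hN : 0 < normalisation P R W w a ρ aρ zstar (aρ * x) :=
    mul_pos (hB.gumbel.infinite_endpoint _) hT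
  simp only [Pi.div_apply]
  rw [div_div_div_cancel_right₀ hN.ne']

lemma jointEvent_pos (hB : ModelB P R W I₁ I₂ w a ρ aρ c ε zstar zinv h) {x : ℝ} (hx : 0 < x) :
    0 < P.real (jointEvent R W I₁ I₂ ρ zstar x (a * x)) := by
  have h1 := hB.le_measureReal_jointEvent x 1 0 0
  simp only [mul_zero, zero_div, add_zero] at h1
  exact (mul_pos hB.I_pos (hB.radialModel.jointExcess_pos (mul_pos hB.aρ_pos hx))).trans_le h1

/-- The functional dependence model. -/
theorem main {Ω' : Type*} [MeasurableSpace Ω'] {P' : Measure Ω'} [IsProbabilityMeasure P']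
    {X Y : Ω' → ℝ} (hX : Measurable X) (hY : Measurable Y)
    (hB : ModelB P R W I₁ I₂ w a ρ aρ c ε zstar zinv h)
    (hid : IdentDistrib (fun ω => (X ω, Y ω))
      (fun ω => (R ω * I₁ ω * W ω, ρ * R ω * I₁ ω * W ω + R ω * I₂ ω * zstar (W ω))) P' P) :
    ConvergesInLaw (excessLaw P' X Y a (fun x => w (aρ * x)))
      ((expMeasure (aρ / (c * a + 1))).prod (expMeasure (aρ * c / (c * a + 1)))) := by
  have ha := hB.a_mem.1
  have haρ := hB.aρ_pos
  have hc := hB.c_pos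
  have hD : 0 < aρ / (c * a + 1) := by positivity
  have hD' : 0 < aρ * c / (c * a + 1) := by positivity
  have := isProbabilityMeasure_expMeasure hD
  have := isProbabilityMeasure_expMeasure hD'
  have hPQ : ∀ u v, P'.real {ω | u < X ω ∧ v < Y ω}
      = P.real (jointEvent R W I₁ I₂ ρ zstar u v) := hid.measureReal_gt_gt
  have hpos : ∀ x, 0 < x → 0 < P'.real (exceedance X Y a x) := fun x hx => by
    rw [exceedance, hPQ]
    exact hB.jointEvent_pos hx
  set S : ℝ → ℝ → ℝ := fun s t =>
    Real.exp (-(aρ / (c * a + 1) * s)) * Real.exp (-(aρ * c / (c * a + 1) * t)) with hS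
  obtain ⟨μ, hμ, hμS, hconv⟩ := exists_convergesInLaw_excessLaw (P := P') (a := a)
    (g := fun x => w (aρ * x)) (S := S) hX hY
    (fun x hx => hB.gumbel.w_pos _ (by positivity)) hpos
    (fun s t hs ht => by
      simp only [exceedance, hPQ]
      exact hB.tendsto_jointEvent_ratio hs ht)
    (fun s t hs ht => by
      have hn : ∀ n : ℕ, (0 : ℝ) < 1 / (n + 1) := fun n => Nat.one_div_pos_of_nat
      refine ⟨fun n => s + 1 / (n + 1), fun n => t + 1 / (n + 1), fun n => ?_, fun n => ?_, ?_⟩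
      · linarith [hn n]
      · linarith [hn n]
      · have hcont : Continuous fun d : ℝ => S (s + d) (t + d) := by
          simp only [hS]
          fun_prop
        have := (hcont.tendsto 0).comp tendsto_one_div_add_atTop_nhds_zero_nat
        simpa [Function.comp_def] using this)
    (by simp [hS])
  have hf := isOpenEmbedding_realProd
  set L := (expMeasure (aρ / (c * a + 1))).prod (expMeasure (aρ * c / (c * a + 1))) with hL
  have hLf : L.map (fun p : ℝ × ℝ => ((p.1 : EReal), (p.2 : EReal))) = μ := by
    have hLS : ∀ s t : ℝ, 0 ≤ s → 0 ≤ t →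
        L.map (fun p : ℝ × ℝ => ((p.1 : EReal), (p.2 : EReal)))
          (Ioi (s : EReal) ×ˢ Ioi (t : EReal)) = ENNReal.ofReal (S s t) := by
      intro s t hs ht
      rw [hf.measurableEmbedding.map_apply]
      have : (fun p : ℝ × ℝ => ((p.1 : EReal), (p.2 : EReal))) ⁻¹'
          (Ioi (s : EReal) ×ˢ Ioi (t : EReal)) = Ioi s ×ˢ Ioi t := by
        ext p
        simp
      rw [this, hL, Measure.prod_prod, expMeasure_Ioi hD hs, expMeasure_Ioi hD' ht,
        ← ENNReal.ofReal_mul (Real.exp_pos _).le]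
    have hone : ∀ ν : Measure (EReal × EReal), (∀ s t : ℝ, 0 ≤ s → 0 ≤ t →
        ν (Ioi (s : EReal) ×ˢ Ioi (t : EReal)) = ENNReal.ofReal (S s t)) →
        ν (Ioi 0 ×ˢ Ioi 0) = 1 := by
      intro ν hν
      simpa [hS] using hν 0 0 le_rfl le_rfl
    have := Measure.isProbabilityMeasure_map (μ := L)
      hf.measurableEmbedding.measurable.aemeasurable
    exact Measure.ext_of_survivor (hone _ hLS) (hone _ hμS) fun s t hs ht =>
      (hLS s t hs ht).trans (hμS s t hs ht).symm
  refine ConvergesInLaw.of_map hf (fun x hx => ?_) ?_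
  · exact isProbabilityMeasure_excessLaw hX hY (hpos x hx)
  · rwa [hLf]

end ModelB

theorem mainTheorem4 {Ω Ω₀ : Type*} [MeasurableSpace Ω] [MeasurableSpace Ω₀]
    (P : Measure Ω) [IsProbabilityMeasure P] (Q : Measure Ω₀) [IsProbabilityMeasure Q]
    (X Y : Ω → ℝ) (hX : Measurable X) (hY : Measurable Y)
    (R : Ω₀ → ℝ) (w : ℝ → ℝ) (a : ℝ) :
    (∀ (U₁ U₂ : Ω₀ → ℝ) (ξ : ℝ → ℝ → ℝ → ℝ),
      ModelA Q R U₁ U₂ w a ξ →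
      IdentDistrib (fun ω => (X ω, Y ω)) (fun ω => (R ω * U₁ ω, R ω * U₂ ω)) P Q →
      (∀ δ η : ℝ, 0 ≤ δ → 0 ≤ η →
        IntegrableOn (fun s => ξ s δ η * Real.exp (-s)) (Ioi δ) ∧ 0 < Jint ξ δ η) ∧
      (∀ s t : ℝ, 0 ≤ s → 0 ≤ t →
        Tendsto (fun x : ℝ => (P[|exceedance X Y a x]).real
            {ω | s / w x < X ω - x ∧ t / w x < Y ω - a * x})
          atTop (𝓝 (Jint ξ s (t / a) / Jint ξ 0 0))) ∧
      (∃ L : Measure (ℝ × EReal),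
        L (Ioi 0 ×ˢ Ioi 0) = 1 ∧
        (∀ s t : ℝ, 0 ≤ s → 0 ≤ t →
          L (Ioi s ×ˢ Ioi (t : EReal)) = ENNReal.ofReal (Jint ξ s (t / a) / Jint ξ 0 0)) ∧
        ConvergesInLaw (excessLawExt P X Y a w) L) ∧
      (Tendsto (fun t => Jint ξ 0 t) atTop (𝓝 0) →
        ∃ L : Measure (ℝ × ℝ),
          L (Ioi 0 ×ˢ Ioi 0) = 1 ∧
          (∀ s t : ℝ, 0 ≤ s → 0 ≤ t →
            L (Ioi s ×ˢ Ioi t) = ENNReal.ofReal (Jint ξ s (t / a) / Jint ξ 0 0)) ∧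
          ConvergesInLaw (excessLaw P X Y a w) L)) ∧
    (∀ (W I₁ I₂ : Ω₀ → ℝ) (ρ aρ c ε : ℝ) (zstar zinv h : ℝ → ℝ),
      ModelB Q R W I₁ I₂ w a ρ aρ c ε zstar zinv h →
      IdentDistrib (fun ω => (X ω, Y ω))
        (fun ω => (R ω * I₁ ω * W ω, ρ * R ω * I₁ ω * W ω + R ω * I₂ ω * zstar (W ω))) P Q →
      ConvergesInLaw (excessLaw P X Y a (fun x => w (aρ * x)))
        ((expMeasure (aρ / (c * a + 1))).prod (expMeasure (aρ * c / (c * a + 1))))) := by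
  exact ⟨fun U₁ U₂ ξ h hid => h.main hX hY hid,
    fun W I₁ I₂ ρ aρ c ε zstar zinv d h hid => h.main hX hY hid⟩
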